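/- Let $\Lambda$ be a finite-dimensional associative unital $\mathbb{C}$-algebra and let $A,B,A',B',L$ be $\Lambda$-modules that are finite-dimensional over $\mathbb{C}$. *Quadruples.* Let $\mathcal{Q}(L)$ be the set of quadruples $(a,b,a',b')$ in $\mathrm{Hom}_\Lambda(L,A)\times\mathrm{Hom}_\Lambda(B,L)\times\mathrm{Hom}_\Lambda(L,A')\times\mathrm{Hom}_\Lambda(B',L)$ such that $$0\to B\xrightarrow{b}L\xrightarrow{a}A\to0\quad\text{and}\quad 0\to B'\xrightarrow{b'}L\xrightarrow{a'}A'\to0$$ are exact. *Octets.* Given submodules $S\subseteq A$, $T\subseteq B$ (with inclusions $u_S,u_T$ and projections $q_S,q_T$) and exact sequences $$0\to T\xrightarrow{e_1}B'\xrightarrow{e_3}S\to0,\qquad 0\to B/T\xrightarrow{e_2}A'\xrightarrow{e_4}A/S\to0,$$ put $Y=(B\oplus B')/\{(t,-e_1(t)) : t\in T\}$ (the pushout), $X=\{(x,x')\in A\oplus A' : q_S(x)=e_4(x')\}$ (the pullback), and let $f:Y\to X$ be the map $[(y,y')]\mapsto(e_3(y'),e_2(q_T(y)))$. There is an exact sequence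 $0\to T\to Y\xrightarrow{f}X\to A/S\to0$; let $\varepsilon(A/S,S,B/T,T)\in\mathrm{Ext}^2_\Lambda(A/S,T)$ be its class. Let $\mathcal{O}(L)$ be the set of octets $(S,T,e_1,e_2,e_3,e_4,c,d)$ of such data with $\varepsilon(A/S,S,B/T,T)=0$, where $c:L\to X$ is an epimorphism and $d:Y\to L$ a monomorphism of $\Lambda$-modules with $f=cd$, and $\dim L=\dim X+\dim Y-\dim\operatorname{Im}f$. *Strata.* Fix $\mathbb{C}$-bases $\alpha_1,\dots,\alpha_m$ of $A$ and $\beta_1,\dots,\beta_n$ of $B$. A submodule $S\subseteq A$ of dimension $r$ lies in the stratum $I=\{i_1<\dots<i_r\}\subseteq\{1,\dots,m\}$ if $I$ is the lexicographically first set of rows for which the maximal minor of an $m\times r$ matrix whose columns are a basis of $S$ is non-zero; $S$ then has a unique basis (its normal basis) for which the submatrix with rows $I$ is the identity, and $A/S$ is identified with the span of the $\alpha_i$, $i\notin I$. Likewise for submodules $T\subseteq B$ and $J\subseteq\{1,\dots,n\}$. Let $\mathcal{O}(L)_{I,J}$ be the set of octets with $S$ in the stratum $I$ and $T$ in the stratum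 $J$, and $\mathcal{Q}(L)_{I,J}$ the set of quadruples with $ab'(B')$ in the stratum $I$ and $b^{-1}(b'(B'))$ in the stratum $J$. A point of $\mathcal{Q}(L)_{I,J}$ is regarded as a point of the vector space of all quadruples of homomorphisms. A point of $\mathcal{O}(L)_{I,J}$ is regarded as a point of a finite-dimensional complex vector space through the normal bases of $S$ and $T$, the images under $e_1$ of the normal basis of $T$, the maps $e_2q_T:B\to A'$ and $u_Se_3:B'\to A$, the map $e_4$ (a linear map from $A'$ to the span of the $\alpha_i$, $i\notin I$), and the maps $L\xrightarrow{c}X\subseteq A\oplus A'$ and $B\oplus B'\to Y\xrightarrow{d}L$. **Proposition 5.6.** There is a bijection $\eta:\mathcal{Q}(L)\to\mathcal{O}(L)$ that sends $(a,b,a',b')$ to the octet with $$S=ab'(B'),\quad T=b^{-1}(b'(B')),\quad e_1=b'^{-1}b,\quad e_2=a'bq_T^{-1},\quad e_3=ab',\quad e_4=q_Saa'^{-1},$$ $$c=(a,a'),\qquad d\ \text{induced by}\ (y,y')\mapsto b(y)+b'(y').$$ For all choices of bases of $A$ and $B$, the sets $\mathcal{Q}(L)_{I,J}$ form a finite partition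 of $\mathcal{Q}(L)$ and the sets $\mathcal{O}(L)_{I,J}$ a finite partition of $\mathcal{O}(L)$; each of these sets is a quasi-affine variety (its coordinates are injective and their image is Zariski locally closed); and for all $I,J$ the map $\eta$ restricts to a homeomorphism $\mathcal{Q}(L)_{I,J}\to\mathcal{O}(L)_{I,J}$ for the Zariski topologies which, together with its inverse, is a morphism of varieties. -/

import Mathlib

open CategoryTheory CategoryTheory.Abelian

universe u

/-! ### Complex varieties inside affine spaces, in coordinates

A quasi-affine variety is a locally closed subset of a finite-dimensional complex vector space `V`,
with its Zariski topology and its regular functions.  We present its points by a type `X` together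
with a coordinate map `ι : X → V`. -/

namespace Variety

section

variable {V W : Type*} [AddCommGroup V] [Module ℂ V] [AddCommGroup W] [Module ℂ W]

/-- The polynomial functions on a vector space: the algebra generated by the linear forms. -/
def polyFun (V : Type*) [AddCommGroup V] [Module ℂ V] : Subalgebra ℂ (V → ℂ) :=
  Algebra.adjoin ℂ {f | ∃ φ : Module.Dual ℂ V, f = fun v => φ v}

/-- The Zariski topology on a vector space, with the non-vanishing loci of polynomial functions as
basic open sets. -/
@[reducible] def zariski (V : Type*) [AddCommGroup V] [Module ℂ V] : TopologicalSpace V :=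
  TopologicalSpace.generateFrom {U | ∃ p ∈ polyFun V, U = {v | p v ≠ 0}}

/-- The Zariski topology on `X` coming from the coordinates `ι : X → V`. -/
@[reducible] def zariskiOn {X : Type*} (ι : X → V) : TopologicalSpace X :=
  (zariski V).induced ι

/-- The coordinates `ι : X → V` present `X` as a quasi-affine variety. -/
def IsVariety {X : Type*} (ι : X → V) : Prop :=
  Function.Injective ι ∧ @IsLocallyClosed V (zariski V) (Set.range ι)

/-- A regular function: near every point it is a quotient of two polynomial functions. -/
def IsRegular {X : Type*} (ι : X → V) (f : X → ℂ) : Prop :=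
  ∀ x : X, ∃ p ∈ polyFun V, ∃ q ∈ polyFun V,
    q (ι x) ≠ 0 ∧ ∀ y : X, q (ι y) ≠ 0 → f y = p (ι y) / q (ι y)

/-- A morphism between quasi-affine varieties: the coordinates of the image point are regular
functions. -/
def IsMorphism {X Y : Type*} (ι : X → V) (κ : Y → W) (F : X → Y) : Prop :=
  ∀ φ : Module.Dual ℂ W, IsRegular ι (fun x => φ (κ (F x)))

end

end Variety

/-! ### The Yoneda class of a four-term exact sequence -/

section Yoneda

variable {Λ : Type u} [Ring Λ] {K Y X C : Type u}
  [AddCommGroup K] [Module Λ K] [AddCommGroup Y] [Module Λ Y]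
  [AddCommGroup X] [Module Λ X] [AddCommGroup C] [Module Λ C]

/-- `0 → K → Y → Im f → 0`, as a complex. -/
def leftComplex (i : K →ₗ[Λ] Y) (f : Y →ₗ[Λ] X) (h : Function.Exact i f) :
    ShortComplex (ModuleCat.{u} Λ) :=
  ShortComplex.moduleCatMk i f.rangeRestrict (by
    ext x
    simpa using h.apply_apply_eq_zero x)

/-- `0 → Im f → X → C → 0`, as a complex. -/
def rightComplex (f : Y →ₗ[Λ] X) (p : X →ₗ[Λ] C) (h : Function.Exact f p) :
    ShortComplex (ModuleCat.{u} Λ) :=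
  ShortComplex.moduleCatMk (LinearMap.range f).subtype p (by
    ext ⟨x, y, rfl⟩
    simpa using h.apply_apply_eq_zero y)

theorem leftComplex_shortExact (i : K →ₗ[Λ] Y) (f : Y →ₗ[Λ] X) (hi : Function.Injective i)
    (h : Function.Exact i f) : (leftComplex i f h).ShortExact := by
  apply ModuleCat.shortComplex_shortExact
  · have key : Function.Exact i f.rangeRestrict := fun y => by
      rw [← h y, ← Subtype.coe_inj]
      rfl
    exact key
  · exact hi
  · exact f.surjective_rangeRestrict

theorem rightComplex_shortExact (f : Y →ₗ[Λ] X) (p : X →ₗ[Λ] C) (h : Function.Exact f p)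
    (hp : Function.Surjective p) : (rightComplex f p h).ShortExact := by
  apply ModuleCat.shortComplex_shortExact
  · have key : Function.Exact (LinearMap.range f).subtype p := fun x => by
      rw [h x]
      simp
    exact key
  · exact (LinearMap.range f).injective_subtype
  · exact hp

/-- The class in `Ext²(C, K)` of the exact sequence `0 → K → Y → X → C → 0`: the Yoneda product of
the classes of `0 → Im f → X → C → 0` and `0 → K → Y → Im f → 0`. -/
noncomputable def yonedaClass (i : K →ₗ[Λ] Y) (f : Y →ₗ[Λ] X) (p : X →ₗ[Λ] C)
    (hi : Function.Injective i) (hif : Function.Exact i f) (hfp : Function.Exact f p)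
    (hp : Function.Surjective p) : Ext (ModuleCat.of Λ C) (ModuleCat.of Λ K) 2 :=
  Ext.comp (Y := ModuleCat.of Λ (LinearMap.range f))
    (rightComplex_shortExact f p hfp hp).extClass
    (leftComplex_shortExact i f hi hif).extClass (by norm_num)

end Yoneda

/-! ### Crossing short exact sequences -/

section Quadruples

variable (Λ : Type u) [Ring Λ] [Algebra ℂ Λ] (A B A' B' L : Type u)
  [AddCommGroup A] [Module ℂ A] [Module Λ A] [IsScalarTower ℂ Λ A]
  [AddCommGroup B] [Module ℂ B] [Module Λ B] [IsScalarTower ℂ Λ B]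
  [AddCommGroup A'] [Module ℂ A'] [Module Λ A'] [IsScalarTower ℂ Λ A']
  [AddCommGroup B'] [Module ℂ B'] [Module Λ B'] [IsScalarTower ℂ Λ B']
  [AddCommGroup L] [Module ℂ L] [Module Λ L] [IsScalarTower ℂ Λ L]

/-- The affine space of all quadruples `(a, b, a', b')` of homomorphisms
`L → A`, `B → L`, `L → A'`, `B' → L`. -/
abbrev QuadSpace : Type u :=
  (L →ₗ[Λ] A) × (B →ₗ[Λ] L) × (L →ₗ[Λ] A') × (B' →ₗ[Λ] L)

/-- The quadruples for which `0 → B → L → A → 0` and `0 → B' → L → A' → 0` are exact. -/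
def Quadruples : Set (QuadSpace Λ A B A' B' L) :=
  {q | (Function.Injective q.2.1 ∧ Function.Exact q.2.1 q.1 ∧ Function.Surjective q.1) ∧
    (Function.Injective q.2.2.2 ∧ Function.Exact q.2.2.2 q.2.2.1 ∧
      Function.Surjective q.2.2.1)}

end Quadruples

/-! ### Frames: the four short exact sequences around the boundary -/

/-- Submodules `S ⊆ A`, `T ⊆ B` and exact sequences `0 → T → B' → S → 0`,
`0 → B/T → A' → A/S → 0`. -/
structure Frame (Λ : Type u) [Ring Λ] (A B A' B' : Type u)
    [AddCommGroup A] [Module Λ A] [AddCommGroup B] [Module Λ B]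
    [AddCommGroup A'] [Module Λ A'] [AddCommGroup B'] [Module Λ B'] where
  S : Submodule Λ A
  T : Submodule Λ B
  e₁ : T →ₗ[Λ] B'
  e₂ : (B ⧸ T) →ₗ[Λ] A'
  e₃ : B' →ₗ[Λ] S
  e₄ : A' →ₗ[Λ] (A ⧸ S)
  inj₁ : Function.Injective e₁
  exact₁₃ : Function.Exact e₁ e₃
  surj₃ : Function.Surjective e₃
  inj₂ : Function.Injective e₂
  exact₂₄ : Function.Exact e₂ e₄
  surj₄ : Function.Surjective e₄

namespace Frame

section

variable {Λ : Type u} [Ring Λ] {A B A' B' : Type u}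
  [AddCommGroup A] [Module Λ A] [AddCommGroup B] [Module Λ B]
  [AddCommGroup A'] [Module Λ A'] [AddCommGroup B'] [Module Λ B']

/-- The relations `(t, -e₁ t)`, `t ∈ T`, in `B ⊕ B'`. -/
def relations (F : Frame Λ A B A' B') : Submodule Λ (B × B') :=
  LinearMap.range (F.T.subtype.prod (-F.e₁))

/-- The pushout of `B ← T → B'`. -/
abbrev Pushout (F : Frame Λ A B A' B') : Type u :=
  (B × B') ⧸ F.relations

/-- The pullback of `A → A/S ← A'`, as a submodule of `A ⊕ A'`. -/
def pullback (F : Frame Λ A B A' B') : Submodule Λ (A × A') :=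
  LinearMap.eqLocus (F.S.mkQ ∘ₗ LinearMap.fst Λ A A') (F.e₄ ∘ₗ LinearMap.snd Λ A A')

theorem mem_pullback (F : Frame Λ A B A' B') (x : A × A') :
    x ∈ F.pullback ↔ F.S.mkQ x.1 = F.e₄ x.2 := Iff.rfl

/-- The map `B ⊕ B' → A ⊕ A'`, `(x, y) ↦ (e₃ y, e₂ [x])`. -/
def preMid (F : Frame Λ A B A' B') : (B × B') →ₗ[Λ] (A × A') :=
  (F.S.subtype ∘ₗ F.e₃ ∘ₗ LinearMap.snd Λ B B').prod
    (F.e₂ ∘ₗ F.T.mkQ ∘ₗ LinearMap.fst Λ B B')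

theorem preMid_apply (F : Frame Λ A B A' B') (x : B) (y : B') :
    F.preMid (x, y) = ((F.e₃ y : A), F.e₂ (F.T.mkQ x)) := rfl

theorem preMid_mem (F : Frame Λ A B A' B') (z : B × B') : F.preMid z ∈ F.pullback := by
  obtain ⟨x, y⟩ := z
  rw [mem_pullback, preMid_apply]
  simp only [F.exact₂₄.apply_apply_eq_zero]
  simp

theorem relations_le (F : Frame Λ A B A' B') :
    F.relations ≤ LinearMap.ker (F.preMid.codRestrict F.pullback F.preMid_mem) := by
  rintro _ ⟨t, rfl⟩
  rw [LinearMap.mem_ker]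
  apply Subtype.ext
  change F.preMid ((t : B), -F.e₁ t) = 0
  rw [preMid_apply]
  simp [F.exact₁₃.apply_apply_eq_zero, (Submodule.Quotient.mk_eq_zero F.T).2 t.2]

/-- The canonical map `f` from the pushout to the pullback. -/
def mid (F : Frame Λ A B A' B') : F.Pushout →ₗ[Λ] F.pullback :=
  F.relations.liftQ (F.preMid.codRestrict F.pullback F.preMid_mem) F.relations_le

theorem mid_mk (F : Frame Λ A B A' B') (x : B) (y : B') :
    (F.mid (F.relations.mkQ (x, y)) : A × A') = ((F.e₃ y : A), F.e₂ (F.T.mkQ x)) := rfl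

/-- The map `T → Y` into the pushout. -/
def left (F : Frame Λ A B A' B') : F.T →ₗ[Λ] F.Pushout :=
  F.relations.mkQ ∘ₗ LinearMap.inl Λ B B' ∘ₗ F.T.subtype

/-- The map `X → A/S` from the pullback. -/
def right (F : Frame Λ A B A' B') : F.pullback →ₗ[Λ] (A ⧸ F.S) :=
  F.S.mkQ ∘ₗ LinearMap.fst Λ A A' ∘ₗ F.pullback.subtype

theorem left_injective (F : Frame Λ A B A' B') : Function.Injective F.left := by
  rw [← LinearMap.ker_eq_bot, LinearMap.ker_eq_bot']
  intro t ht
  obtain ⟨s, hs⟩ := (Submodule.Quotient.mk_eq_zero F.relations).1 ht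
  have h1 : (s : B) = t := congrArg Prod.fst hs
  have h2 : -F.e₁ s = 0 := congrArg Prod.snd hs
  have h3 : s = 0 := F.inj₁ (by simpa using h2)
  apply Subtype.ext
  rw [← h1, h3]

theorem exact_left_mid (F : Frame Λ A B A' B') : Function.Exact F.left F.mid := by
  intro z
  obtain ⟨⟨x, y⟩, rfl⟩ := F.relations.mkQ_surjective z
  rw [← Subtype.coe_inj, mid_mk]
  constructor
  · intro h
    have h1 : F.e₃ y = 0 := Subtype.ext (congrArg Prod.fst h)
    have h2 : F.e₂ (F.T.mkQ x) = 0 := congrArg Prod.snd h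
    have h3 : F.T.mkQ x = 0 := F.inj₂ (by simpa using h2)
    have hx : x ∈ F.T := (Submodule.Quotient.mk_eq_zero F.T).1 h3
    obtain ⟨s, rfl⟩ := (F.exact₁₃ y).1 h1
    refine ⟨⟨x, hx⟩ + s, ?_⟩
    refine (Submodule.Quotient.eq F.relations).2 ⟨s, ?_⟩
    simp
  · rintro ⟨t, ht⟩
    rw [← mid_mk, ← ht]
    change ((F.mid (F.relations.mkQ ((t : B), 0)) : F.pullback) : A × A') = 0
    rw [mid_mk]
    simp [(Submodule.Quotient.mk_eq_zero F.T).2 t.2]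

theorem exact_mid_right (F : Frame Λ A B A' B') : Function.Exact F.mid F.right := by
  rintro ⟨⟨a, a'⟩, h⟩
  have h' : F.S.mkQ a = F.e₄ a' := h
  change F.S.mkQ a = 0 ↔ _
  constructor
  · intro h0
    rw [h0] at h'
    obtain ⟨w, rfl⟩ := (F.exact₂₄ a').1 h'.symm
    obtain ⟨x, rfl⟩ := F.T.mkQ_surjective w
    obtain ⟨y, hy⟩ := F.surj₃ ⟨a, (Submodule.Quotient.mk_eq_zero F.S).1 h0⟩
    refine ⟨F.relations.mkQ (x, y), Subtype.ext ?_⟩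
    rw [mid_mk, hy]
  · rintro ⟨z, hz⟩
    obtain ⟨⟨x, y⟩, rfl⟩ := F.relations.mkQ_surjective z
    have h1 : (F.e₃ y : A) = a := congrArg (fun w : F.pullback => (w : A × A').1) hz
    rw [← h1]
    exact (Submodule.Quotient.mk_eq_zero F.S).2 (F.e₃ y).2

theorem right_surjective (F : Frame Λ A B A' B') : Function.Surjective F.right := by
  intro w
  obtain ⟨a, rfl⟩ := F.S.mkQ_surjective w
  obtain ⟨a', h⟩ := F.surj₄ (F.S.mkQ a)
  exact ⟨⟨(a, a'), h.symm⟩, rfl⟩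

/-- The class `ε(A/S, S, B/T, T)` in `Ext²(A/S, T)` of `0 → T → Y → X → A/S → 0`. -/
noncomputable def obstruction (F : Frame Λ A B A' B') :
    Ext (ModuleCat.of Λ (A ⧸ F.S)) (ModuleCat.of Λ F.T) 2 :=
  yonedaClass F.left F.mid F.right F.left_injective F.exact_left_mid F.exact_mid_right
    F.right_surjective

end

end Frame

/-! ### Octets -/

/-- An octet `(S, T, e₁, e₂, e₃, e₄, c, d)`: a frame with vanishing class, and a factorization
`f = c d` of the canonical map through `L` with `c` epi, `d` mono and
`dim L = dim X + dim Y - dim Im f`. -/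
structure Octet (Λ : Type u) [Ring Λ] [Algebra ℂ Λ] (A B A' B' L : Type u)
    [AddCommGroup A] [Module ℂ A] [Module Λ A] [IsScalarTower ℂ Λ A]
    [AddCommGroup B] [Module ℂ B] [Module Λ B] [IsScalarTower ℂ Λ B]
    [AddCommGroup A'] [Module ℂ A'] [Module Λ A'] [IsScalarTower ℂ Λ A']
    [AddCommGroup B'] [Module ℂ B'] [Module Λ B'] [IsScalarTower ℂ Λ B']
    [AddCommGroup L] [Module ℂ L] [Module Λ L] [IsScalarTower ℂ Λ L]
    extends Frame Λ A B A' B' where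
  c : L →ₗ[Λ] toFrame.pullback
  d : toFrame.Pushout →ₗ[Λ] L
  surj_c : Function.Surjective c
  inj_d : Function.Injective d
  factor : c ∘ₗ d = toFrame.mid
  finrank_eq : Module.finrank ℂ L + Module.finrank ℂ (LinearMap.range toFrame.mid) =
    Module.finrank ℂ toFrame.pullback + Module.finrank ℂ toFrame.Pushout
  obstruction_eq_zero : toFrame.obstruction = 0

/-! ### Echelon strata of the Grassmannian -/

namespace Echelon

section

variable {Λ : Type u} [Ring Λ] [Algebra ℂ Λ] {A : Type u}
  [AddCommGroup A] [Module ℂ A] [Module Λ A] [IsScalarTower ℂ Λ A]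

/-- The indices of the strata: a size `r` and indices `i₁ < ⋯ < i_r` in `{1, …, m}`. -/
abbrev Index (m : ℕ) : Type :=
  Σ r : Fin (m + 1), (Fin r ↪o Fin m)

/-- The coordinates with indices in `I` of the elements of `S`. -/
noncomputable def coords {m r : ℕ} (β : Module.Basis (Fin m) ℂ A) (I : Fin r ↪o Fin m)
    (S : Submodule Λ A) : S →ₗ[ℂ] (Fin r → ℂ) :=
  LinearMap.pi fun k => β.coord (I k) ∘ₗ (S.restrictScalars ℂ).subtype

theorem coords_apply {m r : ℕ} (β : Module.Basis (Fin m) ℂ A) (I : Fin r ↪o Fin m)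
    (S : Submodule Λ A) (s : S) (k : Fin r) : coords β I S s k = β.repr (s : A) (I k) := rfl

/-- `S` lies in the stratum `I`: for a matrix whose columns form a basis of `S`, the maximal minor
with rows `I` is non-zero (equivalently, the coordinates with indices in `I` identify `S` with
`ℂʳ`), and `I` is lexicographically minimal with this property. -/
structure InCell {m r : ℕ} (β : Module.Basis (Fin m) ℂ A) (I : Fin r ↪o Fin m)
    (S : Submodule Λ A) : Prop where
  bijective : Function.Bijective (coords β I S)
  minimal : ∀ I' : Fin r ↪o Fin m, toLex (I' : Fin r → Fin m) < toLex (I : Fin r → Fin m) →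
    ¬ Function.Bijective (coords β I' S)

/-- The normal form of `S`: the basis of `S` whose coordinates with indices in `I` form the
identity matrix. -/
noncomputable def normalBasis {m r : ℕ} {β : Module.Basis (Fin m) ℂ A} {I : Fin r ↪o Fin m}
    {S : Submodule Λ A} (h : InCell β I S) : Module.Basis (Fin r) ℂ S :=
  Module.Basis.ofEquivFun (LinearEquiv.ofBijective (coords β I S) h.bijective)

theorem normalBasis_repr {m r : ℕ} {β : Module.Basis (Fin m) ℂ A} {I : Fin r ↪o Fin m}
    {S : Submodule Λ A} (h : InCell β I S) (s : S) (k : Fin r) :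
    (normalBasis h).repr s k = β.repr (s : A) (I k) := rfl

/-- The linear map `A → A` that subtracts from `x` the element of `S` with the same coordinates in
`I`. -/
noncomputable def reduce {m r : ℕ} {β : Module.Basis (Fin m) ℂ A} {I : Fin r ↪o Fin m}
    {S : Submodule Λ A} (h : InCell β I S) : A →ₗ[ℂ] A :=
  LinearMap.id - ∑ k : Fin r, (β.coord (I k)).smulRight ((normalBasis h k : S) : A)

theorem reduce_apply {m r : ℕ} {β : Module.Basis (Fin m) ℂ A} {I : Fin r ↪o Fin m}
    {S : Submodule Λ A} (h : InCell β I S) (x : A) :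
    reduce h x = x - ∑ k : Fin r, β.repr x (I k) • ((normalBasis h k : S) : A) := by
  simp [reduce]

theorem le_ker_reduce {m r : ℕ} {β : Module.Basis (Fin m) ℂ A} {I : Fin r ↪o Fin m}
    {S : Submodule Λ A} (h : InCell β I S) :
    S.restrictScalars ℂ ≤ LinearMap.ker (reduce h) := by
  intro x hx
  have hx' : x ∈ S := hx
  rw [LinearMap.mem_ker, reduce_apply, sub_eq_zero]
  have key := congrArg (fun s : S => (s : A)) ((normalBasis h).sum_repr ⟨x, hx'⟩)
  simp only [normalBasis_repr] at key
  refine key.symm.trans ?_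
  exact map_sum (S.restrictScalars ℂ).subtype _ _

/-- The section of `A → A/S` that picks the representative with vanishing coordinates in `I`. It
identifies `A/S` with the span of the basis vectors outside `I`. -/
noncomputable def lift {m r : ℕ} {β : Module.Basis (Fin m) ℂ A} {I : Fin r ↪o Fin m}
    {S : Submodule Λ A} (h : InCell β I S) : (A ⧸ S) →ₗ[ℂ] A :=
  (S.restrictScalars ℂ).liftQ (reduce h) (le_ker_reduce h) ∘ₗ
    (Submodule.Quotient.restrictScalarsEquiv ℂ S).symm.toLinearMap

theorem lift_mk {m r : ℕ} {β : Module.Basis (Fin m) ℂ A} {I : Fin r ↪o Fin m}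
    {S : Submodule Λ A} (h : InCell β I S) (x : A) :
    lift h (S.mkQ x) = reduce h x := rfl

end

end Echelon

/-! ### Strata and their coordinates -/

section Strata

variable {Λ : Type u} [Ring Λ] [Algebra ℂ Λ] {A B A' B' L : Type u}
  [AddCommGroup A] [Module ℂ A] [Module Λ A] [IsScalarTower ℂ Λ A]
  [AddCommGroup B] [Module ℂ B] [Module Λ B] [IsScalarTower ℂ Λ B]
  [AddCommGroup A'] [Module ℂ A'] [Module Λ A'] [IsScalarTower ℂ Λ A']
  [AddCommGroup B'] [Module ℂ B'] [Module Λ B'] [IsScalarTower ℂ Λ B']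
  [AddCommGroup L] [Module ℂ L] [Module Λ L] [IsScalarTower ℂ Λ L]

/-- The stratum of the octets with `S` in the stratum `I` of the Grassmannian of `A` and `T` in the
stratum `J` of the Grassmannian of `B`. -/
def octetStratum {m n : ℕ} (α : Module.Basis (Fin m) ℂ A) (β : Module.Basis (Fin n) ℂ B)
    (I : Echelon.Index m) (J : Echelon.Index n) : Set (Octet Λ A B A' B' L) :=
  {o | Echelon.InCell α I.2 o.S ∧ Echelon.InCell β J.2 o.T}

/-- The stratum of the quadruples with `a b' (B')` in the stratum `I` of the Grassmannian of `A` and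
`b⁻¹ (b' (B'))` in the stratum `J` of the Grassmannian of `B`. -/
def quadStratum {m n : ℕ} (α : Module.Basis (Fin m) ℂ A) (β : Module.Basis (Fin n) ℂ B)
    (I : Echelon.Index m) (J : Echelon.Index n) : Set (Quadruples Λ A B A' B' L) :=
  {q | Echelon.InCell α I.2 (LinearMap.range (q.1.1 ∘ₗ q.1.2.2.2)) ∧
    Echelon.InCell β J.2 ((LinearMap.range q.1.2.2.2).comap q.1.2.1)}

/-- The coordinates on a stratum of quadruples: the inclusion into the space of all quadruples of
homomorphisms. -/
def quadCoord {m n : ℕ} (α : Module.Basis (Fin m) ℂ A) (β : Module.Basis (Fin n) ℂ B)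
    (I : Echelon.Index m) (J : Echelon.Index n)
    (q : (quadStratum α β I J : Set (Quadruples Λ A B A' B' L))) : QuadSpace Λ A B A' B' L :=
  q.1.1

/-- The affine space in which a stratum of octets lives. -/
abbrev OctetSpace (Λ : Type u) [Ring Λ] [Algebra ℂ Λ] (A B A' B' L : Type u)
    [AddCommGroup A] [Module ℂ A] [Module Λ A] [IsScalarTower ℂ Λ A]
    [AddCommGroup B] [Module ℂ B] [Module Λ B] [IsScalarTower ℂ Λ B]
    [AddCommGroup A'] [Module ℂ A'] [Module Λ A'] [IsScalarTower ℂ Λ A']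
    [AddCommGroup B'] [Module ℂ B'] [Module Λ B'] [IsScalarTower ℂ Λ B']
    [AddCommGroup L] [Module ℂ L] [Module Λ L] [IsScalarTower ℂ Λ L] (r s : ℕ) : Type u :=
  (Fin r → A) × (Fin s → B) × (Fin s → B') × (B →ₗ[Λ] A') × (B' →ₗ[Λ] A) × (A' →ₗ[ℂ] A) ×
    (L →ₗ[Λ] A × A') × (B × B' →ₗ[Λ] L)

/-- The coordinates on a stratum of octets.  The submodules `S` and `T` are given by their normal
form, `e₁` by the images of the normal basis of `T`, `e₄` in terms of the identification of `A/S`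
with a fixed coordinate subspace of `A`; homomorphisms into the submodules `S ⊆ A`, `X ⊆ A ⊕ A'`
are composed with the inclusion, those out of the quotients `B/T`, `Y = (B ⊕ B')/T` with the
projection. -/
noncomputable def octetCoord {m n : ℕ} (α : Module.Basis (Fin m) ℂ A)
    (β : Module.Basis (Fin n) ℂ B) (I : Echelon.Index m) (J : Echelon.Index n)
    (o : (octetStratum α β I J : Set (Octet Λ A B A' B' L))) :
    OctetSpace Λ A B A' B' L I.1 J.1 :=
  (fun k => (Echelon.normalBasis o.2.1 k : o.1.S),
    fun k => (Echelon.normalBasis o.2.2 k : o.1.T),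
    fun k => o.1.e₁ (Echelon.normalBasis o.2.2 k),
    o.1.e₂ ∘ₗ o.1.T.mkQ,
    o.1.S.subtype ∘ₗ o.1.e₃,
    Echelon.lift o.2.1 ∘ₗ o.1.e₄.restrictScalars ℂ,
    o.1.pullback.subtype ∘ₗ o.1.c,
    o.1.d ∘ₗ o.1.relations.mkQ)

/-- The octet `o` arises from the quadruple `q = (a, b, a', b')`:
`S = a b' (B')`, `T = b⁻¹ (b' (B'))`, `e₁ = b'⁻¹ b`, `e₂ = a' b q_T⁻¹`, `e₃ = a b'`,
`e₄ = q_S a a'⁻¹`, `c = (a, a')`, `d = (b, b')`. -/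
structure IsInduced (q : Quadruples Λ A B A' B' L) (o : Octet Λ A B A' B' L) : Prop where
  S_eq : o.S = LinearMap.range (q.1.1 ∘ₗ q.1.2.2.2)
  T_eq : o.T = (LinearMap.range q.1.2.2.2).comap q.1.2.1
  e₁_eq : ∀ t : o.T, q.1.2.2.2 (o.e₁ t) = q.1.2.1 t
  e₂_eq : ∀ x : B, o.e₂ (o.T.mkQ x) = q.1.2.2.1 (q.1.2.1 x)
  e₃_eq : ∀ y : B', (o.e₃ y : A) = q.1.1 (q.1.2.2.2 y)
  e₄_eq : ∀ l : L, o.e₄ (q.1.2.2.1 l) = o.S.mkQ (q.1.1 l)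
  c_eq : ∀ l : L, (o.c l : A × A') = (q.1.1 l, q.1.2.2.1 l)
  d_eq : ∀ (x : B) (y : B'), o.d (o.relations.mkQ (x, y)) = q.1.2.1 x + q.1.2.2.2 y

end Strata

/-!
Two short exact sequences `0 → B → L → A → 0` and `0 → B' → L → A' → 0` through the same module
`L` are the same thing as a factorization of the canonical map `f` from the pushout `Y` of
`B ← T → B'` to the pullback `X` of `A → A/S ← A'` as an epimorphism `c = (a, a')` after a
monomorphism `d = (b, b')`, where `S = a b' (B')` and `T = b⁻¹ (b' (B'))`.

*The bijection.* From a quadruple, the maps `e₁, …, e₄` are obtained by factoring through injections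
and surjections (`exists_octet_isInduced`). The obstruction class vanishes because
`0 → T → L → X → 0` is exact: the extension `0 → T → Y → Im f → 0` is then the restriction of an
extension of `X`, and its product with the class of `0 → Im f → X → A/S → 0` is zero
(`yonedaClass_eq_zero`). Conversely, `a, a'` are the components of `c` and `b, b'` those of `d`;
the sequences are exact in the middle because `dim L = dim X + dim Y - dim Im f` amounts to
`dim L = dim A + dim B = dim A' + dim B'` (`exists_quadruple_isInduced`).

*The strata of quadruples* are locally closed: the rank of a regular family of linear maps is lower
semicontinuous (`IsRegularMap.isOpen_le_finrank_range`), and on quadruples `S` is the image of `a b'`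
and `T` is the kernel of `a' b`, so that membership in a stratum is expressed by ranks of
regular families (`Echelon.inCell_range_iff`, `Echelon.inCell_ker_iff`).

*The strata of octets.* The inverse of the bijection is the restriction of a linear map
`octetToQuad` of the ambient spaces. The bijection itself is a morphism since each coordinate of the
octet is the unique solution of a system of linear equations with regular coefficients, hence
regular by Cramer's rule (`IsRegularMap.solve`, `isMorphism_of_isInduced`). A bijective morphism
with linear inverse carries a locally closed set to a locally closed set
(`IsVariety.of_linear_symm`), so no equations for the octets are needed.
-/

namespace Variety

section

variable {V W M N P X : Type*} [AddCommGroup V] [Module ℂ V] [AddCommGroup W] [Module ℂ W]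
  [AddCommGroup M] [Module ℂ M] [AddCommGroup N] [Module ℂ N] [AddCommGroup P] [Module ℂ P]
  {ι : X → V}

/-! ### Regular functions and regular maps -/

theorem dual_mem_polyFun (φ : Module.Dual ℂ V) : (fun v => φ v) ∈ polyFun V :=
  Algebra.subset_adjoin ⟨φ, rfl⟩

theorem comp_linearMap_mem_polyFun (k : W →ₗ[ℂ] V) {p : V → ℂ} (hp : p ∈ polyFun V) :
    (fun w => p (k w)) ∈ polyFun W := by
  induction hp using Algebra.adjoin_induction with
  | mem x hx =>
    obtain ⟨φ, rfl⟩ := hx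
    exact dual_mem_polyFun (φ ∘ₗ k)
  | algebraMap r => exact (polyFun W).algebraMap_mem r
  | add x y _ _ hx hy => exact (polyFun W).add_mem hx hy
  | mul x y _ _ hx hy => exact (polyFun W).mul_mem hx hy

theorem isRegular_of_mem_polyFun (ι : X → V) {p : V → ℂ} (hp : p ∈ polyFun V) :
    IsRegular ι (fun x => p (ι x)) := fun _ =>
  ⟨p, hp, 1, (polyFun V).one_mem, one_ne_zero, fun y _ => by simp⟩

/-- The algebra of regular functions. -/
def regularFun (ι : X → V) : Subalgebra ℂ (X → ℂ) where
  carrier := {f | IsRegular ι f}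
  mul_mem' := by
    intro f g hf hg x
    obtain ⟨p, hp, q, hq, hqx, h⟩ := hf x
    obtain ⟨p', hp', q', hq', hqx', h'⟩ := hg x
    refine ⟨p * p', (polyFun V).mul_mem hp hp', q * q', (polyFun V).mul_mem hq hq',
      mul_ne_zero hqx hqx', fun y hy => ?_⟩
    simp only [Pi.mul_apply] at hy ⊢
    rw [h y (left_ne_zero_of_mul hy), h' y (right_ne_zero_of_mul hy), div_mul_div_comm]
  add_mem' := by
    intro f g hf hg x
    obtain ⟨p, hp, q, hq, hqx, h⟩ := hf x
    obtain ⟨p', hp', q', hq', hqx', h'⟩ := hg x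
    refine ⟨p * q' + q * p', (polyFun V).add_mem ((polyFun V).mul_mem hp hq')
      ((polyFun V).mul_mem hq hp'), q * q', (polyFun V).mul_mem hq hq',
      mul_ne_zero hqx hqx', fun y hy => ?_⟩
    simp only [Pi.mul_apply, Pi.add_apply] at hy ⊢
    rw [h y (left_ne_zero_of_mul hy), h' y (right_ne_zero_of_mul hy),
      div_add_div _ _ (left_ne_zero_of_mul hy) (right_ne_zero_of_mul hy)]
  algebraMap_mem' r := isRegular_of_mem_polyFun ι ((polyFun V).algebraMap_mem r)

theorem mem_regularFun {f : X → ℂ} : f ∈ regularFun ι ↔ IsRegular ι f := Iff.rfl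

theorem IsRegular.sum {J : Type*} (s : Finset J) {f : J → X → ℂ} (hf : ∀ j ∈ s, IsRegular ι (f j)) :
    IsRegular ι (fun x => ∑ j ∈ s, f j x) := by
  have := (regularFun ι).sum_mem hf
  rw [mem_regularFun] at this
  convert this using 1
  ext x
  simp

/-- A function that is locally a quotient of two regular functions is regular. -/
theorem isRegular_of_locally_mul_eq {f : X → ℂ}
    (h : ∀ x, ∃ g s, IsRegular ι g ∧ IsRegular ι s ∧ s x ≠ 0 ∧ ∀ y, s y * f y = g y) :
    IsRegular ι f := by
  intro x
  obtain ⟨g, s, hg, hs, hsx, hf⟩ := h x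
  obtain ⟨p, hp, q, hq, hqx, h⟩ := hg x
  obtain ⟨p', hp', q', hq', hqx', h'⟩ := hs x
  have hpx' : p' (ι x) ≠ 0 := by
    intro h0
    rw [h' x hqx', h0, zero_div] at hsx
    exact hsx rfl
  -- The factor `q'` in numerator and denominator makes the formula for `s` available where the
  -- denominator is non-zero.
  refine ⟨p * q' * q', (polyFun V).mul_mem ((polyFun V).mul_mem hp hq') hq', q * p' * q',
    (polyFun V).mul_mem ((polyFun V).mul_mem hq hp') hq', ?_, fun y hy => ?_⟩
  · exact mul_ne_zero (mul_ne_zero hqx hpx') hqx'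
  · simp only [Pi.mul_apply] at hy ⊢
    have h1 := right_ne_zero_of_mul hy
    have h2 := left_ne_zero_of_mul (left_ne_zero_of_mul hy)
    have h3 := right_ne_zero_of_mul (left_ne_zero_of_mul hy)
    have key := hf y
    rw [h y h2, h' y h1] at key
    field_simp at key ⊢
    linear_combination key

/-- A map to a vector space all of whose coordinates are regular functions. -/
def IsRegularMap (ι : X → V) (F : X → M) : Prop :=
  ∀ φ : Module.Dual ℂ M, IsRegular ι (fun x => φ (F x))

theorem isRegularMap_self (ι : X → V) : IsRegularMap ι ι := fun φ =>
  isRegular_of_mem_polyFun ι (dual_mem_polyFun φ)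

theorem isRegularMap_const (ι : X → V) (m : M) : IsRegularMap ι (fun _ => m) := fun φ =>
  (regularFun ι).algebraMap_mem (φ m)

namespace IsRegularMap

theorem map {F : X → M} (hF : IsRegularMap ι F) (l : M →ₗ[ℂ] N) :
    IsRegularMap ι (fun x => l (F x)) := fun φ => hF (φ ∘ₗ l)

theorem add {F G : X → M} (hF : IsRegularMap ι F) (hG : IsRegularMap ι G) :
    IsRegularMap ι (fun x => F x + G x) := fun φ => by
  simp only [map_add]
  exact (regularFun ι).add_mem (hF φ) (hG φ)

theorem sub {F G : X → M} (hF : IsRegularMap ι F) (hG : IsRegularMap ι G) :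
    IsRegularMap ι (fun x => F x - G x) := fun φ => by
  simp only [map_sub]
  exact (regularFun ι).sub_mem (hF φ) (hG φ)

theorem sum {J : Type*} (s : Finset J) {F : J → X → M} (hF : ∀ j ∈ s, IsRegularMap ι (F j)) :
    IsRegularMap ι (fun x => ∑ j ∈ s, F j x) := fun φ => by
  simp only [map_sum]
  exact IsRegular.sum s fun j hj => hF j hj φ

theorem prodMk {F : X → M} {G : X → N} (hF : IsRegularMap ι F) (hG : IsRegularMap ι G) :
    IsRegularMap ι (fun x => (F x, G x)) := by
  simpa using (hF.map (LinearMap.inl ℂ M N)).add (hG.map (LinearMap.inr ℂ M N))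

theorem pi {J : Type*} [Finite J] {F : X → J → M} (hF : ∀ j, IsRegularMap ι (fun x => F x j)) :
    IsRegularMap ι F := by
  classical
  have := Fintype.ofFinite J
  have h := sum Finset.univ (fun j _ => (hF j).map (LinearMap.single ℂ (fun _ : J => M) j))
  simpa [Finset.univ_sum_single] using h

/-- Regularity can be tested after an injective linear map, because linear forms extend. -/
theorem of_injective {F : X → M} (l : M →ₗ[ℂ] N) (hl : Function.Injective l)
    (h : IsRegularMap ι (fun x => l (F x))) : IsRegularMap ι F := by
  obtain ⟨r, hr⟩ := l.exists_leftInverse_of_injective (LinearMap.ker_eq_bot.2 hl)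
  have := h.map r
  simpa only [← LinearMap.comp_apply, hr, LinearMap.id_apply] using this

theorem bilin [Module.Finite ℂ M] {F : X → M} {G : X → N} (hF : IsRegularMap ι F)
    (hG : IsRegularMap ι G) (b : M →ₗ[ℂ] N →ₗ[ℂ] P) :
    IsRegularMap ι (fun x => b (F x) (G x)) := fun φ => by
  let e := Module.finBasis ℂ M
  have h := IsRegular.sum Finset.univ
    (f := fun j x => e.repr (F x) j * φ (b (e j) (G x)))
    (fun j _ => (regularFun ι).mul_mem (hF (e.coord j)) (hG (φ ∘ₗ b (e j))))
  convert h using 1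
  ext x
  change φ (b (F x) (G x)) = _
  conv_lhs => rw [← e.sum_repr (F x)]
  simp only [map_sum, map_smul, LinearMap.sum_apply, LinearMap.smul_apply, smul_eq_mul]

theorem comp [Module.Finite ℂ M] [Module.Finite ℂ N] [Module.Finite ℂ P]
    {F : X → (N →ₗ[ℂ] P)} {G : X → (M →ₗ[ℂ] N)} (hF : IsRegularMap ι F)
    (hG : IsRegularMap ι G) : IsRegularMap ι (fun x => F x ∘ₗ G x) :=
  hF.bilin hG (LinearMap.llcomp ℂ M N P)

theorem apply [Module.Finite ℂ M] [Module.Finite ℂ N]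
    {F : X → (M →ₗ[ℂ] N)} {G : X → M} (hF : IsRegularMap ι F)
    (hG : IsRegularMap ι G) : IsRegularMap ι (fun x => F x (G x)) :=
  hF.bilin hG LinearMap.id

theorem det {n : Type*} [Fintype n] [DecidableEq n] {A : X → Matrix n n ℂ}
    (hA : ∀ i j, IsRegular ι (fun x => A x i j)) : IsRegular ι (fun x => (A x).det) := by
  let B : Matrix n n (regularFun ι) := fun i j => ⟨_, hA i j⟩
  have key : ((B.det : regularFun ι) : X → ℂ) = fun x => (A x).det := by
    ext x
    exact ((Pi.evalRingHom (fun _ : X => ℂ) x).comp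
      (regularFun ι).val.toRingHom).map_det B
  rw [← key]
  exact B.det.2

theorem adjugate {n : Type*} [Fintype n] [DecidableEq n] {A : X → Matrix n n ℂ}
    (hA : ∀ i j, IsRegular ι (fun x => A x i j)) (i j : n) :
    IsRegular ι (fun x => (A x).adjugate i j) := by
  let B : Matrix n n (regularFun ι) := fun i j => ⟨_, hA i j⟩
  have key : ((B.adjugate i j : regularFun ι) : X → ℂ) = fun x => (A x).adjugate i j := by
    ext x
    exact congrFun (congrFun (((Pi.evalRingHom (fun _ : X => ℂ) x).comp
      (regularFun ι).val.toRingHom).map_adjugate B) i) j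
  rw [← key]
  exact (B.adjugate i j).2

/-- Cramer's rule: the unique solution of a system of linear equations whose coefficients are
regular maps is a regular map. -/
theorem solve [Module.Finite ℂ M] [Module.Finite ℂ N] {A : X → (M →ₗ[ℂ] N)} {F : X → M}
    {G : X → N} (hA : IsRegularMap ι A) (hG : IsRegularMap ι G)
    (inj : ∀ x, Function.Injective (A x)) (h : ∀ x, A x (F x) = G x) : IsRegularMap ι F := by
  classical
  intro φ
  apply isRegular_of_locally_mul_eq
  intro x₀
  -- Near `x₀` a left inverse of `A x₀` makes the system square.
  obtain ⟨r, hr⟩ := (A x₀).exists_leftInverse_of_injective (LinearMap.ker_eq_bot.2 (inj x₀))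
  let e := Module.finBasis ℂ M
  let B : X → Matrix _ _ ℂ := fun x => LinearMap.toMatrix e e (r ∘ₗ A x)
  have hB : ∀ i j, IsRegular ι (fun x => B x i j) := fun i j => by
    have := ((hA.apply (isRegularMap_const ι (e j))).map r) (e.coord i)
    simpa [B, LinearMap.toMatrix_apply] using this
  have hg : ∀ j, IsRegular ι (fun x => e.repr (r (G x)) j) := fun j => hG.map r (e.coord j)
  refine ⟨fun x => ∑ i, φ (e i) * ∑ j, (B x).adjugate i j * e.repr (r (G x)) j,
    fun x => (B x).det, ?_, det hB, ?_, fun y => ?_⟩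
  · exact IsRegular.sum _ fun i _ => (regularFun ι).mul_mem
      ((regularFun ι).algebraMap_mem (φ (e i)))
      (IsRegular.sum _ fun j _ => (regularFun ι).mul_mem (adjugate hB i j) (hg j))
  · simp [B, hr]
  · have key : (B y).det • (e.repr (F y) : _ → ℂ) =
        (B y).adjugate.mulVec (e.repr (r (G y)) : _ → ℂ) := by
      have h1 : (e.repr (r (G y)) : _ → ℂ) = (B y).mulVec (e.repr (F y)) := by
        rw [LinearMap.toMatrix_mulVec_repr, LinearMap.comp_apply, h]
      rw [h1, Matrix.mulVec_mulVec, Matrix.adjugate_mul, Matrix.smul_mulVec, Matrix.one_mulVec]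
    have h2 : ∀ i, ∑ j, (B y).adjugate i j * e.repr (r (G y)) j =
        (B y).det * e.repr (F y) i := fun i => (congrFun key i).symm
    simp only [h2]
    conv_lhs => rw [← e.sum_repr (F y)]
    simp only [map_sum, map_smul, smul_eq_mul, Finset.mul_sum]
    exact Finset.sum_congr rfl fun i _ => by ring

end IsRegularMap

/-! ### The Zariski topology -/

open Topology

theorem isOpen_ne_of_mem_polyFun {p : V → ℂ} (hp : p ∈ polyFun V) :
    IsOpen[zariski V] {v | p v ≠ 0} :=
  TopologicalSpace.isOpen_generateFrom_of_mem ⟨p, hp, rfl⟩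

theorem IsRegular.isOpen_ne {f : X → ℂ} (hf : IsRegular ι f) :
    IsOpen[zariskiOn ι] {x | f x ≠ 0} := by
  let := zariskiOn ι
  rw [isOpen_iff_mem_nhds]
  intro x hx
  obtain ⟨p, hp, q, hq, hqx, h⟩ := hf x
  have ho : IsOpen {y : X | p (ι y) * q (ι y) ≠ 0} :=
    ⟨_, isOpen_ne_of_mem_polyFun ((polyFun V).mul_mem hp hq), rfl⟩
  have hx' : f x ≠ 0 := hx
  rw [h x hqx] at hx'
  refine Filter.mem_of_superset (ho.mem_nhds
    (mul_ne_zero (fun h0 => hx' (by rw [h0, zero_div])) hqx)) fun y hy => ?_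
  have hq := right_ne_zero_of_mul hy
  change f y ≠ 0
  rw [h y hq]
  exact div_ne_zero (left_ne_zero_of_mul hy) hq

theorem IsRegular.isClosed_eq {f : X → ℂ} (hf : IsRegular ι f) :
    IsClosed[zariskiOn ι] {x | f x = 0} := by
  let := zariskiOn ι
  rw [← isOpen_compl_iff]
  exact hf.isOpen_ne

theorem IsRegularMap.isClosed_eq_zero {F : X → M} (hF : IsRegularMap ι F) :
    IsClosed[zariskiOn ι] {x | F x = 0} := by
  let := zariskiOn ι
  have : {x | F x = 0} = ⋂ φ : Module.Dual ℂ M, {x | φ (F x) = 0} := by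
    ext x
    simp [Module.forall_dual_apply_eq_zero_iff]
  rw [this]
  exact isClosed_iInter fun φ => (hF φ).isClosed_eq

/-- The composition of a polynomial with a regular map is regular. -/
theorem IsRegularMap.comp_polyFun {F : X → M} (hF : IsRegularMap ι F) {p : M → ℂ}
    (hp : p ∈ polyFun M) : IsRegular ι (fun x => p (F x)) := by
  induction hp using Algebra.adjoin_induction with
  | mem x hx =>
    obtain ⟨φ, rfl⟩ := hx
    exact hF φ
  | algebraMap r => exact (regularFun ι).algebraMap_mem r
  | add x y _ _ hx hy => exact (regularFun ι).add_mem hx hy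
  | mul x y _ _ hx hy => exact (regularFun ι).mul_mem hx hy

theorem IsRegularMap.continuous {F : X → M} (hF : IsRegularMap ι F) :
    @Continuous X M (zariskiOn ι) (zariski M) F := by
  let := zariskiOn ι
  refine continuous_generateFrom_iff.2 ?_
  rintro _ ⟨p, hp, rfl⟩
  exact (hF.comp_polyFun hp).isOpen_ne

theorem IsMorphism.continuous {Y : Type*} {κ : Y → W} {F : X → Y} (hF : IsMorphism ι κ F) :
    @Continuous X Y (zariskiOn ι) (zariskiOn κ) F := by
  let := zariskiOn ι
  let := zariski W
  exact continuous_induced_rng.2 (IsRegularMap.continuous hF)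

theorem isHomeomorph_of_isMorphism {Y : Type*} {κ : Y → W} (e : X ≃ Y)
    (h : IsMorphism ι κ e) (h' : IsMorphism κ ι e.symm) :
    @IsHomeomorph X Y (zariskiOn ι) (zariskiOn κ) e := by
  let := zariskiOn ι
  let := zariskiOn κ
  exact (Homeomorph.mk e h.continuous h'.continuous).isHomeomorph

theorem isOpen_of_zariskiOn_id {s : Set V} (h : IsOpen[zariskiOn (id : V → V)] s) :
    IsOpen[zariski V] s := by
  let := zariski V
  rwa [zariskiOn, induced_id] at h

theorem isClosed_of_zariskiOn_id {s : Set V} (h : IsClosed[zariskiOn (id : V → V)] s) :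
    IsClosed[zariski V] s := by
  let := zariski V
  rwa [zariskiOn, induced_id] at h

/-- The rank of a regular family of linear maps is lower semicontinuous. -/
theorem IsRegularMap.isOpen_le_finrank_range [Module.Finite ℂ M] [Module.Finite ℂ N]
    {A : X → (M →ₗ[ℂ] N)} (hA : IsRegularMap ι A) (k : ℕ) :
    IsOpen[zariskiOn ι] {x | k ≤ Module.finrank ℂ (LinearMap.range (A x))} := by
  let := zariskiOn ι
  -- The rank is at least `k` iff some `k × k` matrix `q A p` with constant `p`, `q` is invertible.
  have : {x | k ≤ Module.finrank ℂ (LinearMap.range (A x))} =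
      ⋃ (p : (Fin k → ℂ) →ₗ[ℂ] M) (q : N →ₗ[ℂ] (Fin k → ℂ)),
        {x | (LinearMap.toMatrix' (q ∘ₗ A x ∘ₗ p)).det ≠ 0} := by
    ext x
    simp only [Set.mem_ofPred_eq, Set.mem_iUnion, LinearMap.det_toMatrix']
    constructor
    · intro hk
      obtain ⟨f, hf⟩ := exists_linearIndependent_of_le_finrank hk
      choose g hg using fun i => (f i).2
      let p := (Pi.basisFun ℂ (Fin k)).constr ℂ g
      have hp : Function.Injective (A x ∘ₗ p) := by
        have h1 : A x ∘ₗ p = (Pi.basisFun ℂ (Fin k)).constr ℂ fun i => (f i : N) := by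
          refine (Pi.basisFun ℂ (Fin k)).ext fun i => ?_
          rw [Module.Basis.constr_basis, LinearMap.comp_apply, Module.Basis.constr_basis, hg]
        rw [h1]
        exact (Pi.basisFun ℂ (Fin k)).injective_constr_of_linearIndependent
          (hf.map' _ (Submodule.ker_subtype _))
      obtain ⟨q, hq⟩ := (A x ∘ₗ p).exists_leftInverse_of_injective (LinearMap.ker_eq_bot.2 hp)
      exact ⟨p, q, by rw [hq, LinearMap.det_id]; exact one_ne_zero⟩
    · rintro ⟨p, q, h⟩
      have hinj : Function.Injective (q ∘ₗ A x ∘ₗ p) :=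
        (LinearMap.equivOfDetNeZero _ h).injective
      let r := (q ∘ₗ (LinearMap.range (A x)).subtype)
      have hr : Function.Surjective r := by
        intro w
        obtain ⟨v, rfl⟩ := (LinearMap.injective_iff_surjective.1 hinj) w
        exact ⟨⟨A x (p v), LinearMap.mem_range_self _ _⟩, rfl⟩
      simpa using LinearMap.finrank_le_finrank_of_surjective hr
  rw [this]
  refine isOpen_iUnion fun p => isOpen_iUnion fun q => ?_
  refine (IsRegularMap.det fun i j => ?_).isOpen_ne
  have := ((hA.apply (isRegularMap_const ι (p (Pi.single j 1)))).map q) (LinearMap.proj i)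
  simpa [LinearMap.toMatrix'_apply] using this

theorem IsRegularMap.isClosed_finrank_range_le [Module.Finite ℂ M] [Module.Finite ℂ N]
    {A : X → (M →ₗ[ℂ] N)} (hA : IsRegularMap ι A) (k : ℕ) :
    IsClosed[zariskiOn ι] {x | Module.finrank ℂ (LinearMap.range (A x)) ≤ k} := by
  let := zariskiOn ι
  rw [← isOpen_compl_iff]
  convert hA.isOpen_le_finrank_range (k + 1) using 1
  ext x
  simp

theorem IsRegularMap.isOpen_injective [Module.Finite ℂ M] [Module.Finite ℂ N]
    {A : X → (M →ₗ[ℂ] N)} (hA : IsRegularMap ι A) :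
    IsOpen[zariskiOn ι] {x | Function.Injective (A x)} := by
  convert hA.isOpen_le_finrank_range (Module.finrank ℂ M) using 1
  ext x
  have h := (A x).finrank_range_add_finrank_ker
  simp only [Set.mem_ofPred_eq, ← LinearMap.ker_eq_bot, ← Submodule.finrank_eq_zero (R := ℂ)]
  lia

theorem IsRegularMap.isOpen_surjective [Module.Finite ℂ M] [Module.Finite ℂ N]
    {A : X → (M →ₗ[ℂ] N)} (hA : IsRegularMap ι A) :
    IsOpen[zariskiOn ι] {x | Function.Surjective (A x)} := by
  convert hA.isOpen_le_finrank_range (Module.finrank ℂ N) using 1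
  ext x
  simp only [Set.mem_ofPred_eq, ← LinearMap.range_eq_top]
  constructor
  · intro h
    rw [h, finrank_top]
  · intro h
    exact Submodule.eq_top_of_finrank_eq (le_antisymm (Submodule.finrank_le _) h)

/-- Let `e` be a bijective morphism whose inverse is given by a linear map `k` of the ambient
spaces.  If the source is a quasi-affine variety, then so is the target: its image is the closed
subset `{w | κ (e (k w)) = w}` of the locally closed preimage of the source under `k`. -/
theorem IsVariety.of_linear_symm {Y : Type*} {κ : Y → W} (hι : IsVariety ι) (e : X ≃ Y)
    (he : IsMorphism ι κ e) (k : W →ₗ[ℂ] V) (hk : ∀ y, k (κ y) = ι (e.symm y)) :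
    IsVariety κ := by
  let := zariski V
  let := zariski W
  refine ⟨fun y y' h => e.symm.injective (hι.1 (by rw [← hk, ← hk, h])), ?_⟩
  let Z : Set W := k ⁻¹' Set.range ι
  have hcont : Continuous k := by
    have := ((isRegularMap_self (id : W → W)).map k).continuous
    rwa [zariskiOn, induced_id] at this
  have hZ : IsLocallyClosed Z := hι.2.preimage hcont
  choose g hg using fun z : Z => z.2
  have hg' : ∀ f : X → ℂ, IsRegular ι f → IsRegular (Subtype.val : Z → W) (fun z => f (g z)) := by
    intro f hf z
    obtain ⟨p, hp, q, hq, hqx, h⟩ := hf (g z)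
    refine ⟨_, comp_linearMap_mem_polyFun k hp, _, comp_linearMap_mem_polyFun k hq, ?_, ?_⟩
    · rwa [← hg z]
    · intro y hy
      rw [← hg y] at hy ⊢
      exact h _ hy
  have hF : IsRegularMap (Subtype.val : Z → W) (fun z => κ (e (g z)) - z.1) :=
    IsRegularMap.sub (fun φ => hg' _ (he φ)) (isRegularMap_self _)
  have hcl := hF.isClosed_eq_zero
  have key : Set.range κ = Subtype.val '' {z : Z | κ (e (g z)) - z.1 = 0} := by
    ext w
    constructor
    · rintro ⟨y, rfl⟩
      refine ⟨⟨κ y, e.symm y, (hk y).symm⟩, ?_, rfl⟩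
      have : g ⟨κ y, e.symm y, (hk y).symm⟩ = e.symm y := hι.1 (by rw [hg, hk])
      simp [this]
    · rintro ⟨z, hz, rfl⟩
      exact ⟨_, sub_eq_zero.1 hz⟩
  rw [key]
  refine (IsClosed.isLocallyClosed hcl).image Topology.IsInducing.subtypeVal ?_
  rwa [Subtype.range_val]

end

end Variety

/-! ### Cells of images and kernels -/

namespace Echelon

section

variable {Λ : Type u} [Ring Λ] [Algebra ℂ Λ] {A B : Type u}
  [AddCommGroup A] [Module ℂ A] [Module Λ A] [IsScalarTower ℂ Λ A]
  [AddCommGroup B] [Module ℂ B] [Module Λ B] [IsScalarTower ℂ Λ B]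
  {m r : ℕ}

/-- The projection of `A` to the coordinates with indices in `I`. -/
noncomputable def proj (α : Module.Basis (Fin m) ℂ A) (I : Fin r ↪o Fin m) :
    A →ₗ[ℂ] (Fin r → ℂ) :=
  LinearMap.pi fun k => α.coord (I k)

theorem finrank_eq_of_bijective {α : Module.Basis (Fin m) ℂ A} {I : Fin r ↪o Fin m}
    {S : Submodule Λ A} (h : Function.Bijective (coords α I S)) : Module.finrank ℂ S = r := by
  simpa using (LinearEquiv.ofBijective _ h).finrank_eq

theorem finite_submodule (α : Module.Basis (Fin m) ℂ A) (S : Submodule Λ A) :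
    Module.Finite ℂ S := by
  have := Module.Finite.of_basis α
  exact inferInstanceAs (Module.Finite ℂ (S.restrictScalars ℂ))

theorem finrank_submodule_le (α : Module.Basis (Fin m) ℂ A) (S : Submodule Λ A) :
    Module.finrank ℂ S ≤ m := by
  have := Module.Finite.of_basis α
  have h := (S.restrictScalars ℂ).finrank_le
  rwa [Module.finrank_eq_card_basis α, Fintype.card_fin] at h

/-- Every submodule has a set of coordinates that identify it with a coordinate space, because the
restrictions of the coordinate forms span its dual. -/
theorem exists_bijective_coords (α : Module.Basis (Fin m) ℂ A) (S : Submodule Λ A)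
    (hr : Module.finrank ℂ S = r) :
    ∃ I : Fin r ↪o Fin m, Function.Bijective (coords α I S) := by
  have := finite_submodule α S
  let v : Fin m → Module.Dual ℂ S := fun i => α.coord i ∘ₗ (S.restrictScalars ℂ).subtype
  obtain ⟨κ, f, hf, hspan, hli⟩ := exists_linearIndependent' ℂ v
  have := Finite.of_injective f hf
  have := Fintype.ofFinite κ
  have hv : ∀ s : S, (∀ k, v (f k) s = 0) → s = 0 := by
    intro s hs
    have h1 : ∀ w ∈ Submodule.span ℂ (Set.range v), w s = 0 := by
      rw [← hspan]
      intro w hw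
      induction hw using Submodule.span_induction with
      | mem x hx =>
        obtain ⟨k, rfl⟩ := hx
        exact hs k
      | zero => rfl
      | add x y _ _ hx hy => rw [LinearMap.add_apply, hx, hy, add_zero]
      | smul c x _ hx => rw [LinearMap.smul_apply, hx, smul_zero]
    apply Subtype.ext
    refine α.ext_elem fun i => ?_
    rw [ZeroMemClass.coe_zero, map_zero]
    exact h1 (v i) (Submodule.subset_span ⟨i, rfl⟩)
  have hle : Fintype.card κ ≤ r := by
    have := hli.fintype_card_le_finrank
    rwa [Subspace.dual_finrank_eq, hr] at this
  have hge : r ≤ Fintype.card κ := by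
    have := LinearMap.finrank_le_finrank_of_injective (f := LinearMap.pi fun k => v (f k))
      ((injective_iff_map_eq_zero _).2 fun s hs => hv s fun k => congrFun hs k)
    simpa [hr] using this
  have hcard : (Finset.univ.image f).card = r := by
    rw [Finset.card_image_of_injective _ hf, Finset.card_univ]
    lia
  let I := (Finset.univ.image f).orderEmbOfFin hcard
  refine ⟨I, ?_⟩
  have hinj : Function.Injective (coords α I S) := by
    refine (injective_iff_map_eq_zero _).2 fun s hs => hv s fun k => ?_
    have hk : f k ∈ Set.range I := by
      rw [Finset.range_orderEmbOfFin]
      simp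
    obtain ⟨j, hj⟩ := hk
    rw [← hj]
    exact congrFun hs j
  exact ⟨hinj, (LinearMap.injective_iff_surjective_of_finrank_eq_finrank (by simp [hr])).1 hinj⟩

/-- Every submodule lies in exactly one stratum. -/
theorem existsUnique_inCell (α : Module.Basis (Fin m) ℂ A) (S : Submodule Λ A) :
    ∃! I : Index m, InCell α I.2 S := by
  obtain ⟨I₀, h₀⟩ := exists_bijective_coords α S rfl
  have hfin : Finite (Fin (Module.finrank ℂ S) ↪o Fin m) :=
    Finite.of_injective (fun I => (I : Fin _ → Fin m)) DFunLike.coe_injective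
  obtain ⟨I, hI, hmin⟩ := Set.exists_min_image {I | Function.Bijective (coords α I S)}
    (fun I => toLex (I : Fin _ → Fin m)) (Set.toFinite _) ⟨I₀, h₀⟩
  refine ⟨⟨⟨Module.finrank ℂ S, Nat.lt_succ_of_le (finrank_submodule_le α S)⟩, I⟩,
    ⟨hI, fun I' hlt hb => (hmin I' hb).not_gt hlt⟩, ?_⟩
  rintro ⟨⟨r, hr⟩, I'⟩ h'
  obtain rfl : Module.finrank ℂ S = r := finrank_eq_of_bijective h'.bijective
  have h1 := h'.minimal I
  have heq : I' = I := by
    apply DFunLike.coe_injective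
    apply toLex.injective
    exact le_antisymm (not_lt.1 fun hlt => h1 hlt hI) (hmin I' h'.bijective)
  rw [heq]

theorem bijective_coords_range_iff (α : Module.Basis (Fin m) ℂ A) (I : Fin r ↪o Fin m)
    (h : B →ₗ[Λ] A) :
    Function.Bijective (coords α I (LinearMap.range h)) ↔
      Module.finrank ℂ (LinearMap.range (h.restrictScalars ℂ)) ≤ r ∧
        Function.Surjective (proj α I ∘ₗ h.restrictScalars ℂ) := by
  have := finite_submodule α (LinearMap.range h)
  change _ ↔ Module.finrank ℂ (LinearMap.range h) ≤ r ∧ _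
  have hs : Function.Surjective (coords α I (LinearMap.range h)) ↔
      Function.Surjective (proj α I ∘ₗ h.restrictScalars ℂ) := by
    constructor
    · intro hs w
      obtain ⟨⟨_, b, rfl⟩, rfl⟩ := hs w
      exact ⟨b, rfl⟩
    · intro hs w
      obtain ⟨b, rfl⟩ := hs w
      exact ⟨⟨h b, b, rfl⟩, rfl⟩
  rw [← hs]
  constructor
  · intro hb
    exact ⟨(finrank_eq_of_bijective hb).le, hb.2⟩
  · rintro ⟨hle, hsurj⟩
    have hge := LinearMap.finrank_le_finrank_of_surjective hsurj
    refine ⟨(LinearMap.injective_iff_surjective_of_finrank_eq_finrank ?_).2 hsurj, hsurj⟩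
    simp only [Module.finrank_fin_fun] at hge ⊢
    lia

theorem inCell_range_iff (α : Module.Basis (Fin m) ℂ A) (I : Fin r ↪o Fin m) (h : B →ₗ[Λ] A) :
    InCell α I (LinearMap.range h) ↔
      Module.finrank ℂ (LinearMap.range (h.restrictScalars ℂ)) ≤ r ∧
        Function.Surjective (proj α I ∘ₗ h.restrictScalars ℂ) ∧
        ∀ I' : Fin r ↪o Fin m, toLex (I' : Fin r → Fin m) < toLex (I : Fin r → Fin m) →
          ¬ Function.Surjective (proj α I' ∘ₗ h.restrictScalars ℂ) := by
  constructor
  · rintro ⟨hb, hmin⟩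
    obtain ⟨hle, hs⟩ := (bijective_coords_range_iff α I h).1 hb
    exact ⟨hle, hs, fun I' hlt hs' =>
      hmin I' hlt ((bijective_coords_range_iff α I' h).2 ⟨hle, hs'⟩)⟩
  · rintro ⟨hle, hs, hmin⟩
    exact ⟨(bijective_coords_range_iff α I h).2 ⟨hle, hs⟩, fun I' hlt hb =>
      hmin I' hlt ((bijective_coords_range_iff α I' h).1 hb).2⟩

theorem bijective_coords_ker_iff (α : Module.Basis (Fin m) ℂ A) (I : Fin r ↪o Fin m)
    (hr : r ≤ m) (g : A →ₗ[Λ] B) :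
    Function.Bijective (coords α I (LinearMap.ker g)) ↔
      Module.finrank ℂ (LinearMap.range (g.restrictScalars ℂ)) ≤ m - r ∧
        Function.Injective ((g.restrictScalars ℂ).prod (proj α I)) := by
  have := Module.Finite.of_basis α
  have := finite_submodule α (LinearMap.ker g)
  have hrank := (g.restrictScalars ℂ).finrank_range_add_finrank_ker
  rw [Module.finrank_eq_card_basis α, Fintype.card_fin] at hrank
  change _ + Module.finrank ℂ (LinearMap.ker g) = m at hrank
  have hi : Function.Injective (coords α I (LinearMap.ker g)) ↔
      Function.Injective ((g.restrictScalars ℂ).prod (proj α I)) := by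
    rw [injective_iff_map_eq_zero, injective_iff_map_eq_zero]
    constructor
    · intro h x hx
      have h1 : g x = 0 := congrArg Prod.fst hx
      have h2 : proj α I x = 0 := congrArg Prod.snd hx
      exact congrArg Subtype.val (h ⟨x, h1⟩ h2)
    · rintro h ⟨x, hx⟩ h2
      exact Subtype.ext (h x (Prod.ext hx h2))
  rw [← hi]
  constructor
  · intro hb
    have := finrank_eq_of_bijective hb
    exact ⟨by lia, hb.1⟩
  · rintro ⟨hle, hinj⟩
    have hge := LinearMap.finrank_le_finrank_of_injective hinj
    refine ⟨hinj, (LinearMap.injective_iff_surjective_of_finrank_eq_finrank ?_).1 hinj⟩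
    simp only [Module.finrank_fin_fun] at hge ⊢
    lia

theorem inCell_ker_iff (α : Module.Basis (Fin m) ℂ A) (I : Fin r ↪o Fin m) (hr : r ≤ m)
    (g : A →ₗ[Λ] B) :
    InCell α I (LinearMap.ker g) ↔
      Module.finrank ℂ (LinearMap.range (g.restrictScalars ℂ)) ≤ m - r ∧
        Function.Injective ((g.restrictScalars ℂ).prod (proj α I)) ∧
        ∀ I' : Fin r ↪o Fin m, toLex (I' : Fin r → Fin m) < toLex (I : Fin r → Fin m) →
          ¬ Function.Injective ((g.restrictScalars ℂ).prod (proj α I')) := by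
  constructor
  · rintro ⟨hb, hmin⟩
    obtain ⟨hle, hs⟩ := (bijective_coords_ker_iff α I hr g).1 hb
    exact ⟨hle, hs, fun I' hlt hs' =>
      hmin I' hlt ((bijective_coords_ker_iff α I' hr g).2 ⟨hle, hs'⟩)⟩
  · rintro ⟨hle, hs, hmin⟩
    exact ⟨(bijective_coords_ker_iff α I hr g).2 ⟨hle, hs⟩, fun I' hlt hb =>
      hmin I' hlt ((bijective_coords_ker_iff α I' hr g).1 hb).2⟩

theorem proj_normalBasis {α : Module.Basis (Fin m) ℂ A} {I : Fin r ↪o Fin m}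
    {S : Submodule Λ A} (h : InCell α I S) (k : Fin r) :
    proj α I (normalBasis h k : S) = Pi.single k 1 := by
  have := congrArg DFunLike.coe ((normalBasis h).repr_self k)
  rw [Finsupp.single_eq_pi_single] at this
  exact this

/-- An element of `S` is the combination of the normal basis whose coefficients are its coordinates
with indices in `I`. -/
theorem sum_proj_smul_normalBasis {α : Module.Basis (Fin m) ℂ A} {I : Fin r ↪o Fin m}
    {S : Submodule Λ A} (h : InCell α I S) {x : A} (hx : x ∈ S) :
    ∑ k, proj α I x k • ((normalBasis h k : S) : A) = x := by
  have := le_ker_reduce h (show x ∈ S.restrictScalars ℂ from hx)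
  rw [LinearMap.mem_ker, reduce_apply, sub_eq_zero] at this
  exact this.symm

end

end Echelon

/-! ### Vanishing of the Yoneda class -/

/-- The class of `0 → K → Y → X → C → 0` vanishes if `Y → X` factors as `Y → L → X` such that
`0 → K → L → X → 0` is exact: then the extension `Y` of `Im f` by `K` is the restriction of an
extension of `X`. -/
theorem yonedaClass_eq_zero {Λ : Type u} [Ring Λ] {K Y X C L : Type u}
    [AddCommGroup K] [Module Λ K] [AddCommGroup Y] [Module Λ Y]
    [AddCommGroup X] [Module Λ X] [AddCommGroup C] [Module Λ C] [AddCommGroup L] [Module Λ L]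
    {i : K →ₗ[Λ] Y} {f : Y →ₗ[Λ] X} {p : X →ₗ[Λ] C} (hi : Function.Injective i)
    (hif : Function.Exact i f) (hfp : Function.Exact f p) (hp : Function.Surjective p)
    (c : L →ₗ[Λ] X) (d : Y →ₗ[Λ] L) (hcd : c ∘ₗ d = f) (hd : Function.Injective (d ∘ₗ i))
    (hdc : Function.Exact (d ∘ₗ i) c) (hc : Function.Surjective c) :
    yonedaClass i f p hi hif hfp hp = 0 := by
  let E : ShortComplex (ModuleCat.{u} Λ) := ShortComplex.moduleCatMk (d ∘ₗ i) c
    (LinearMap.ext hdc.apply_apply_eq_zero)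
  have hE : E.ShortExact := ModuleCat.shortComplex_shortExact E hdc hd hc
  let φ : leftComplex i f hif ⟶ E :=
    { τ₁ := 𝟙 _
      τ₂ := ModuleCat.ofHom d
      τ₃ := ModuleCat.ofHom (LinearMap.range f).subtype
      comm₁₂ := by
        ext x
        rfl
      comm₂₃ := by
        ext x
        exact LinearMap.congr_fun hcd x }
  have h := ShortComplex.ShortExact.extClass_naturality (leftComplex_shortExact i f hi hif) hE φ
  have h' : (leftComplex_shortExact i f hi hif).extClass =
      (Ext.mk₀ (ModuleCat.ofHom (LinearMap.range f).subtype)).comp hE.extClass (zero_add 1) := by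
    rw [← Ext.comp_mk₀_id (leftComplex_shortExact i f hi hif).extClass]
    exact h
  unfold yonedaClass
  rw [h']
  exact (rightComplex_shortExact f p hfp hp).extClass_comp_assoc _

/-! ### Dimensions in short exact sequences -/

section Dimension

variable {Λ : Type u} [Ring Λ] [Algebra ℂ Λ] {M N P : Type u}
  [AddCommGroup M] [Module ℂ M] [Module Λ M] [IsScalarTower ℂ Λ M]
  [AddCommGroup N] [Module ℂ N] [Module Λ N] [IsScalarTower ℂ Λ N] [Module.Finite ℂ N]
  [AddCommGroup P] [Module ℂ P] [Module Λ P] [IsScalarTower ℂ Λ P]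

theorem finrank_eq_add_of_exact {f : M →ₗ[Λ] N} {g : N →ₗ[Λ] P} (hf : Function.Injective f)
    (hfg : Function.Exact f g) (hg : Function.Surjective g) :
    Module.finrank ℂ N = Module.finrank ℂ M + Module.finrank ℂ P := by
  have h := (g.restrictScalars ℂ).finrank_range_add_finrank_ker
  have h1 : LinearMap.range (g.restrictScalars ℂ) = ⊤ := LinearMap.range_eq_top.2 hg
  have h2 : LinearMap.ker (g.restrictScalars ℂ) = LinearMap.range (f.restrictScalars ℂ) := by
    ext x
    exact hfg x
  have h3 : Module.finrank ℂ (LinearMap.range (f.restrictScalars ℂ)) = Module.finrank ℂ M :=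
    LinearMap.finrank_range_of_inj hf
  rw [h1, finrank_top, h2, h3] at h
  lia

theorem exact_iff_finrank {f : M →ₗ[Λ] N} {g : N →ₗ[Λ] P} (hf : Function.Injective f)
    (hg : Function.Surjective g) :
    Function.Exact f g ↔
      g ∘ₗ f = 0 ∧ Module.finrank ℂ N = Module.finrank ℂ M + Module.finrank ℂ P := by
  constructor
  · intro h
    exact ⟨LinearMap.ext h.apply_apply_eq_zero, finrank_eq_add_of_exact hf h hg⟩
  rintro ⟨hz, hdim⟩
  have h := (g.restrictScalars ℂ).finrank_range_add_finrank_ker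
  have h1 : LinearMap.range (g.restrictScalars ℂ) = ⊤ := LinearMap.range_eq_top.2 hg
  have h3 : Module.finrank ℂ (LinearMap.range (f.restrictScalars ℂ)) = Module.finrank ℂ M :=
    LinearMap.finrank_range_of_inj hf
  rw [h1, finrank_top] at h
  have hle : LinearMap.range (f.restrictScalars ℂ) ≤ LinearMap.ker (g.restrictScalars ℂ) := by
    rintro _ ⟨x, rfl⟩
    exact LinearMap.congr_fun hz x
  have heq := Submodule.eq_of_le_of_finrank_eq hle (by lia)
  intro x
  exact (SetLike.ext_iff.1 heq x).symm

end Dimension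

/-! ### The bijection between quadruples and octets -/

section Bijection

variable {Λ : Type u} [Ring Λ] [Algebra ℂ Λ] {A B A' B' L : Type u}
  [AddCommGroup A] [Module ℂ A] [Module Λ A] [IsScalarTower ℂ Λ A]
  [AddCommGroup B] [Module ℂ B] [Module Λ B] [IsScalarTower ℂ Λ B]
  [AddCommGroup A'] [Module ℂ A'] [Module Λ A'] [IsScalarTower ℂ Λ A']
  [AddCommGroup B'] [Module ℂ B'] [Module Λ B'] [IsScalarTower ℂ Λ B']
  [AddCommGroup L] [Module ℂ L] [Module Λ L] [IsScalarTower ℂ Λ L]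

/-- A map out of the source of a surjection that vanishes on its kernel factors through it. -/
theorem LinearMap.exists_comp_eq_of_surjective {R M N P : Type*} [Ring R] [AddCommGroup M]
    [Module R M] [AddCommGroup N] [Module R N] [AddCommGroup P] [Module R P] (g : M →ₗ[R] N)
    (hg : Function.Surjective g) (f : M →ₗ[R] P) (h : ∀ x, g x = 0 → f x = 0) :
    ∃ e : N →ₗ[R] P, ∀ x, e (g x) = f x := by
  refine ⟨(LinearMap.ker g).liftQ f h ∘ₗ (g.quotKerEquivOfSurjective hg).symm.toLinearMap,
    fun x => ?_⟩
  have : (g.quotKerEquivOfSurjective hg).symm (g x) = (LinearMap.ker g).mkQ x := by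
    rw [LinearEquiv.symm_apply_eq]
    rfl
  rw [LinearMap.comp_apply, LinearEquiv.coe_coe, this]
  rfl

/-- A map into the target of an injection whose values lie in the image factors through it. -/
theorem LinearMap.exists_comp_eq_of_injective {R M N P : Type*} [Ring R] [AddCommGroup M]
    [Module R M] [AddCommGroup N] [Module R N] [AddCommGroup P] [Module R P] (g : M →ₗ[R] N)
    (hg : Function.Injective g) (f : P →ₗ[R] N) (h : ∀ x, f x ∈ LinearMap.range g) :
    ∃ e : P →ₗ[R] M, ∀ x, g (e x) = f x := by
  refine ⟨(LinearEquiv.ofInjective g hg).symm.toLinearMap ∘ₗ f.codRestrict _ h, fun x => ?_⟩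
  exact congrArg Subtype.val ((LinearEquiv.ofInjective g hg).apply_symm_apply
    (f.codRestrict _ h x))

theorem Frame.finrank_pushout [Module.Finite ℂ B] [Module.Finite ℂ B']
    (F : Frame Λ A B A' B') : Module.finrank ℂ F.Pushout =
      Module.finrank ℂ F.T + Module.finrank ℂ (LinearMap.range F.mid) := by
  have h : Function.Exact F.left F.mid.rangeRestrict := fun y => by
    rw [← F.exact_left_mid y, ← Subtype.coe_inj]
    rfl
  exact finrank_eq_add_of_exact (P := LinearMap.range F.mid) F.left_injective h F.mid.surjective_rangeRestrict

/-- Every quadruple induces an octet. -/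
theorem exists_octet_isInduced [Module.Finite ℂ B] [Module.Finite ℂ B'] [Module.Finite ℂ L]
    (q : Quadruples Λ A B A' B' L) : ∃ o : Octet Λ A B A' B' L, IsInduced q o := by
  obtain ⟨⟨a, b, a', b'⟩, ⟨hb, hba, ha⟩, ⟨hb', hba', ha'⟩⟩ := q
  dsimp only at hb hba ha hb' hba' ha'
  let S := LinearMap.range (a ∘ₗ b')
  let T := (LinearMap.range b').comap b
  obtain ⟨e₁, h₁⟩ := b'.exists_comp_eq_of_injective hb' (b ∘ₗ T.subtype) (fun t => t.2)
  obtain ⟨e₂, h₂⟩ := T.mkQ.exists_comp_eq_of_surjective T.mkQ_surjective (a' ∘ₗ b) (by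
    intro x hx
    exact (hba' _).2 ((Submodule.Quotient.mk_eq_zero T).1 hx))
  let e₃ := (a ∘ₗ b').rangeRestrict
  have h₃ : ∀ y, (e₃ y : A) = a (b' y) := fun y => rfl
  obtain ⟨e₄, h₄⟩ := a'.exists_comp_eq_of_surjective ha' (S.mkQ ∘ₗ a) (by
    intro l hl
    obtain ⟨y, rfl⟩ := (hba' l).1 hl
    exact (Submodule.Quotient.mk_eq_zero S).2 ⟨y, rfl⟩)
  simp only [LinearMap.comp_apply, Submodule.subtype_apply] at h₁ h₂ h₄
  let F : Frame Λ A B A' B' :=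
    { S := S
      T := T
      e₁ := e₁
      e₂ := e₂
      e₃ := e₃
      e₄ := e₄
      inj₁ := by
        intro s t h
        have := congrArg b' h
        rw [h₁, h₁] at this
        exact Subtype.ext (hb this)
      exact₁₃ := by
        intro y
        rw [← Subtype.coe_inj, h₃]
        constructor
        · intro h
          obtain ⟨x, hx⟩ := (hba _).1 h
          exact ⟨⟨x, y, hx.symm⟩, hb' (by rw [h₁, hx])⟩
        · rintro ⟨t, rfl⟩
          rw [h₁]
          exact hba.apply_apply_eq_zero _
      surj₃ := LinearMap.surjective_rangeRestrict _
      inj₂ := by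
        rw [injective_iff_map_eq_zero]
        intro w hw
        obtain ⟨x, rfl⟩ := T.mkQ_surjective w
        rw [h₂] at hw
        exact (Submodule.Quotient.mk_eq_zero T).2 ((hba' _).1 hw)
      exact₂₄ := by
        intro x'
        obtain ⟨l, rfl⟩ := ha' x'
        rw [h₄]
        constructor
        · intro h
          obtain ⟨y, hy⟩ := (Submodule.Quotient.mk_eq_zero S).1 h
          obtain ⟨x, hx⟩ := (hba (l - b' y)).1 (by
            rw [map_sub, ← hy]
            exact sub_self _)
          refine ⟨T.mkQ x, ?_⟩
          rw [h₂, hx, map_sub, hba'.apply_apply_eq_zero, sub_zero]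
        · rintro ⟨w, hw⟩
          obtain ⟨x, rfl⟩ := T.mkQ_surjective w
          rw [h₂] at hw
          obtain ⟨y, hy⟩ := (hba' (l - b x)).1 (by rw [map_sub, hw, sub_self])
          refine (Submodule.Quotient.mk_eq_zero S).2 ⟨y, ?_⟩
          rw [LinearMap.comp_apply, hy, map_sub, hba.apply_apply_eq_zero, sub_zero]
      surj₄ := by
        intro w
        obtain ⟨x, rfl⟩ := S.mkQ_surjective w
        obtain ⟨l, rfl⟩ := ha x
        exact ⟨a' l, h₄ l⟩ }
  have hc : ∀ l, (a.prod a') l ∈ F.pullback := fun l => (h₄ l).symm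
  let c : L →ₗ[Λ] F.pullback := (a.prod a').codRestrict _ hc
  have hcl : ∀ l, (c l : A × A') = (a l, a' l) := fun l => rfl
  have hrel : F.relations ≤ LinearMap.ker (b.coprod b') := by
    rintro _ ⟨t, rfl⟩
    change b t + b' (-e₁ t) = 0
    rw [map_neg, h₁, add_neg_cancel]
  let d : F.Pushout →ₗ[Λ] L := F.relations.liftQ (b.coprod b') hrel
  have hdl : ∀ x y, d (F.relations.mkQ (x, y)) = b x + b' y := fun x y => rfl
  have hinj : Function.Injective d := by
    rw [injective_iff_map_eq_zero]
    intro z hz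
    obtain ⟨⟨x, y⟩, rfl⟩ := F.relations.mkQ_surjective z
    rw [hdl] at hz
    have hx : b x = b' (-y) := by
      rw [map_neg]
      exact eq_neg_of_add_eq_zero_left hz
    refine (Submodule.Quotient.mk_eq_zero _).2 ⟨⟨x, -y, hx.symm⟩, Prod.ext rfl ?_⟩
    change -e₁ _ = y
    rw [neg_eq_iff_eq_neg]
    apply hb'
    rw [h₁, hx]
  have hcd : c ∘ₗ d = F.mid := by
    ext z
    · change (a (b z + b' 0), a' (b z + b' 0)).1 = ((e₃ 0 : S) : A)
      simp [hba.apply_apply_eq_zero]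
    · change (a (b z + b' 0), a' (b z + b' 0)).2 = e₂ (T.mkQ z)
      rw [h₂]
      simp
    · change a (b 0 + b' z) = a (b' z)
      simp
    · change (a (b 0 + b' z), a' (b 0 + b' z)).2 = e₂ (T.mkQ 0)
      rw [h₂]
      simp [hba'.apply_apply_eq_zero]
  have hsurj : Function.Surjective c := by
    rintro ⟨⟨x, x'⟩, hx⟩
    obtain ⟨l, rfl⟩ := ha' x'
    have hx' : S.mkQ x = e₄ (a' l) := hx
    rw [h₄] at hx'
    obtain ⟨y, hy⟩ := (Submodule.Quotient.eq S).1 hx'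
    refine ⟨l + b' y, Subtype.ext ?_⟩
    rw [hcl, map_add, map_add, hba'.apply_apply_eq_zero, add_zero]
    refine Prod.ext ?_ rfl
    rw [LinearMap.comp_apply] at hy
    simp only [hy]
    abel
  have hdi : ∀ t, d (F.left t) = b t := fun t => by
    change b t + b' 0 = b t
    simp
  have hdinj : Function.Injective (d ∘ₗ F.left) := by
    rw [LinearMap.coe_comp]
    exact hinj.comp F.left_injective
  have hex : Function.Exact (d ∘ₗ F.left) c := by
    intro l
    rw [← Subtype.coe_inj, hcl]
    constructor
    · intro h
      obtain ⟨x, rfl⟩ := (hba l).1 (congrArg Prod.fst h)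
      exact ⟨⟨x, (hba' _).1 (congrArg Prod.snd h)⟩, hdi _⟩
    · rintro ⟨t, rfl⟩
      rw [LinearMap.comp_apply, hdi, hba.apply_apply_eq_zero]
      exact Prod.ext rfl ((hba' _).2 t.2)
  have hdim := finrank_eq_add_of_exact hdinj hex hsurj
  exact ⟨{ F with
      c := c
      d := d
      surj_c := hsurj
      inj_d := hinj
      factor := hcd
      finrank_eq := by
        rw [hdim, F.finrank_pushout]
        ring
      obstruction_eq_zero :=
        yonedaClass_eq_zero _ _ _ _ c d hcd hdinj hex hsurj },
    rfl, rfl, h₁, h₂, h₃, h₄, hcl, hdl⟩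

/-- The quadruple `(pr₁ c, d i₁, pr₂ c, d i₂)` determined by an octet. -/
theorem exists_quadruple_isInduced [Module.Finite ℂ A] [Module.Finite ℂ B] [Module.Finite ℂ A']
    [Module.Finite ℂ B'] [Module.Finite ℂ L]
    (o : Octet Λ A B A' B' L) : ∃ q : Quadruples Λ A B A' B' L, IsInduced q o := by
  let F := o.toFrame
  let c' : L →ₗ[Λ] A × A' := F.pullback.subtype ∘ₗ o.c
  let d' : B × B' →ₗ[Λ] L := o.d ∘ₗ F.relations.mkQ
  have hcd : ∀ z : B × B', c' (d' z) = ((F.e₃ z.2 : A), F.e₂ (F.T.mkQ z.1)) := fun z => by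
    have := LinearMap.congr_fun o.factor (F.relations.mkQ z)
    exact congrArg Subtype.val this
  have hc' : ∀ l, F.S.mkQ (c' l).1 = F.e₄ (c' l).2 := fun l => (o.c l).2
  have hsurj : ∀ x x', F.S.mkQ x = F.e₄ x' → ∃ l, c' l = (x, x') := fun x x' h => by
    obtain ⟨l, hl⟩ := o.surj_c ⟨(x, x'), h⟩
    exact ⟨l, congrArg Subtype.val hl⟩
  have hinj : ∀ z, d' z = 0 → ∃ t : F.T, (t : B) = z.1 ∧ -F.e₁ t = z.2 := fun z hz => by
    obtain ⟨t, rfl⟩ := (Submodule.Quotient.mk_eq_zero _).1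
      ((injective_iff_map_eq_zero _).1 o.inj_d _ hz)
    exact ⟨t, rfl, rfl⟩
  have hrel : ∀ t : F.T, d' (0, F.e₁ t) = d' ((t : B), 0) := fun t => by
    refine congrArg o.d ((Submodule.Quotient.eq _).2 ⟨-t, ?_⟩)
    simp
  let a := LinearMap.fst Λ A A' ∘ₗ c'
  let a' := LinearMap.snd Λ A A' ∘ₗ c'
  let b := d' ∘ₗ LinearMap.inl Λ B B'
  let b' := d' ∘ₗ LinearMap.inr Λ B B'
  have hb : Function.Injective b := by
    rw [injective_iff_map_eq_zero]
    intro x hx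
    obtain ⟨t, ht, h0⟩ := hinj _ hx
    have : t = 0 := F.inj₁ (by simpa using h0)
    simpa [this] using ht.symm
  have hb' : Function.Injective b' := by
    rw [injective_iff_map_eq_zero]
    intro y hy
    obtain ⟨t, ht, h0⟩ := hinj _ hy
    have : t = 0 := Subtype.ext ht
    simpa [this] using h0.symm
  have ha : Function.Surjective a := by
    intro x
    obtain ⟨x', hx'⟩ := F.surj₄ (F.S.mkQ x)
    obtain ⟨l, hl⟩ := hsurj x x' hx'.symm
    exact ⟨l, congrArg Prod.fst hl⟩
  have ha' : Function.Surjective a' := by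
    intro x'
    obtain ⟨x, hx⟩ := F.S.mkQ_surjective (F.e₄ x')
    obtain ⟨l, hl⟩ := hsurj x x' hx
    exact ⟨l, congrArg Prod.snd hl⟩
  have hab : a ∘ₗ b = 0 := by
    ext x
    refine (congrArg Prod.fst (hcd (x, 0))).trans ?_
    simp
  have hab' : a' ∘ₗ b' = 0 := by
    ext y
    refine (congrArg Prod.snd (hcd (0, y))).trans ?_
    simp
  have hfinX : Module.Finite ℂ F.pullback :=
    inferInstanceAs (Module.Finite ℂ (F.pullback.restrictScalars ℂ))
  -- The dimensions of all modules in sight, from the exact sequences that connect them.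
  have d1 := F.finrank_pushout
  have d2 : Module.finrank ℂ F.pullback =
      Module.finrank ℂ (LinearMap.range F.mid) + Module.finrank ℂ (A ⧸ F.S) := by
    have h : Function.Exact (LinearMap.range F.mid).subtype F.right := fun x => by
      rw [F.exact_mid_right x]
      simp
    exact finrank_eq_add_of_exact (M := LinearMap.range F.mid)
      (LinearMap.range F.mid).injective_subtype h F.right_surjective
  have d3 : Module.finrank ℂ (B × B') = Module.finrank ℂ F.T + Module.finrank ℂ F.Pushout :=
    finrank_eq_add_of_exact (f := F.T.subtype.prod (-F.e₁)) (g := F.relations.mkQ)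
      (fun s t h => Subtype.ext (congrArg Prod.fst h))
      (fun z => Submodule.Quotient.mk_eq_zero F.relations) F.relations.mkQ_surjective
  have d4 : Module.finrank ℂ A = Module.finrank ℂ F.S + Module.finrank ℂ (A ⧸ F.S) :=
    finrank_eq_add_of_exact F.S.injective_subtype (LinearMap.exact_subtype_mkQ F.S)
      F.S.mkQ_surjective
  have d5 : Module.finrank ℂ B = Module.finrank ℂ F.T + Module.finrank ℂ (B ⧸ F.T) :=
    finrank_eq_add_of_exact F.T.injective_subtype (LinearMap.exact_subtype_mkQ F.T)
      F.T.mkQ_surjective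
  have d6 := finrank_eq_add_of_exact F.inj₁ F.exact₁₃ F.surj₃
  have d7 := finrank_eq_add_of_exact F.inj₂ F.exact₂₄ F.surj₄
  have d8 : Module.finrank ℂ L + Module.finrank ℂ (LinearMap.range F.mid) =
    Module.finrank ℂ F.pullback + Module.finrank ℂ F.Pushout := o.finrank_eq
  rw [Module.finrank_prod] at d3
  refine ⟨⟨(a, b, a', b'), ⟨hb, (exact_iff_finrank hb ha).2 ⟨hab, by lia⟩, ha⟩,
    ⟨hb', (exact_iff_finrank hb' ha').2 ⟨hab', by lia⟩, ha'⟩⟩, ?_⟩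
  have hab₃ : ∀ y, (F.e₃ y : A) = a (b' y) := fun y => (congrArg Prod.fst (hcd (0, y))).symm
  refine ⟨?_, ?_, hrel, fun x => (congrArg Prod.snd (hcd (x, 0))).symm, hab₃,
    fun l => (hc' l).symm, fun l => rfl, fun x y => ?_⟩
  · ext x
    constructor
    · intro hx
      obtain ⟨y, hy⟩ := F.surj₃ ⟨x, hx⟩
      exact ⟨y, by rw [LinearMap.comp_apply, ← hab₃, hy]⟩
    · rintro ⟨y, rfl⟩
      rw [LinearMap.comp_apply, ← hab₃]
      exact (F.e₃ y).2
  · ext x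
    constructor
    · intro hx
      exact ⟨F.e₁ ⟨x, hx⟩, hrel ⟨x, hx⟩⟩
    · rintro ⟨y, hy⟩
      obtain ⟨t, ht, -⟩ := hinj (x, -y) (by
        have : ((x, -y) : B × B') = (x, 0) - (0, y) := by simp
        rw [this, map_sub, sub_eq_zero]
        exact hy.symm)
      have ht' : (t : B) = x := ht
      exact ht' ▸ t.2
  · change d' (x, y) = d' (x, 0) + d' (0, y)
    rw [← map_add]
    simp

theorem IsInduced.octet_unique {q : Quadruples Λ A B A' B' L} {o o' : Octet Λ A B A' B' L}
    (h : IsInduced q o) (h' : IsInduced q o') : o = o' := by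
  obtain ⟨⟨a, b, a', b'⟩, ⟨hb, hba, ha⟩, ⟨hb', hba', ha'⟩⟩ := q
  obtain ⟨⟨S, T, e₁, e₂, e₃, e₄, _, _, _, _, _, _⟩, c, d, _, _, _, _, _⟩ := o
  obtain ⟨⟨S', T', e₁', e₂', e₃', e₄', _, _, _, _, _, _⟩, c', d', _, _, _, _, _⟩ := o'
  obtain ⟨hS, hT, h₁, h₂, h₃, h₄, hc, hd⟩ := h
  obtain ⟨hS', hT', h₁', h₂', h₃', h₄', hc', hd'⟩ := h'
  dsimp only at *
  obtain rfl : S = S' := hS.trans hS'.symm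
  obtain rfl : T = T' := hT.trans hT'.symm
  obtain rfl : e₁ = e₁' := LinearMap.ext fun t => hb' ((h₁ t).trans (h₁' t).symm)
  obtain rfl : e₂ = e₂' := LinearMap.ext fun w => by
    obtain ⟨x, rfl⟩ := T.mkQ_surjective w
    exact (h₂ x).trans (h₂' x).symm
  obtain rfl : e₃ = e₃' := LinearMap.ext fun y => Subtype.ext ((h₃ y).trans (h₃' y).symm)
  obtain rfl : e₄ = e₄' := LinearMap.ext fun x' => by
    obtain ⟨l, rfl⟩ := ha' x'
    exact (h₄ l).trans (h₄' l).symm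
  obtain rfl : c = c' := LinearMap.ext fun l => Subtype.ext ((hc l).trans (hc' l).symm)
  obtain rfl : d = d' := LinearMap.ext fun z => by
    obtain ⟨⟨x, y⟩, rfl⟩ := Submodule.mkQ_surjective _ z
    exact (hd x y).trans (hd' x y).symm
  rfl

theorem IsInduced.quadruple_unique {q q' : Quadruples Λ A B A' B' L} {o : Octet Λ A B A' B' L}
    (h : IsInduced q o) (h' : IsInduced q' o) : q = q' := by
  have hc := fun l => (h.c_eq l).symm.trans (h'.c_eq l)
  have hd := fun x y => (h.d_eq x y).symm.trans (h'.d_eq x y)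
  refine Subtype.ext (Prod.ext ?_ (Prod.ext ?_ (Prod.ext ?_ ?_)))
  · exact LinearMap.ext fun l => congrArg Prod.fst (hc l)
  · exact LinearMap.ext fun x => by simpa using hd x 0
  · exact LinearMap.ext fun l => congrArg Prod.snd (hc l)
  · exact LinearMap.ext fun y => by simpa using hd 0 y

end Bijection

/-! ### Regular families of normal bases -/

section NormalBasis

open Variety Echelon

variable {Λ : Type u} [Ring Λ] [Algebra ℂ Λ] {A : Type u}
  [AddCommGroup A] [Module ℂ A] [Module Λ A] [IsScalarTower ℂ Λ A]
  {V X M : Type*} [AddCommGroup V] [Module ℂ V] [AddCommGroup M] [Module ℂ M]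
  [Module.Finite ℂ M] {ι : X → V} {m r : ℕ} {α : Module.Basis (Fin m) ℂ A} {I : Fin r ↪o Fin m}
  {S : X → Submodule Λ A}

/-- The normal basis of the kernel of a regular family `g` is regular: its `k`-th vector is the
unique solution `y` of `g y = 0` whose coordinates in `I` are those of the `k`-th unit vector. -/
theorem Variety.IsRegularMap.normalBasis_ker (hS : ∀ x, InCell α I (S x))
    {g : X → (A →ₗ[ℂ] M)} (hg : IsRegularMap ι g) (h : ∀ x y, y ∈ S x ↔ g x y = 0) (k : Fin r) :
    IsRegularMap ι (fun x => ((normalBasis (hS x) k : S x) : A)) := by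
  have := Module.Finite.of_basis α
  have hA : IsRegularMap ι (fun x => (g x).prod (proj α I)) :=
    (hg.prodMk (isRegularMap_const ι (proj α I))).map
      (LinearMap.prodEquiv (R := ℂ) (M := A) (M₂ := M) (M₃ := Fin r → ℂ) ℂ).toLinearMap
  refine hA.solve (isRegularMap_const ι ((0 : M), (Pi.single k 1 : Fin r → ℂ))) (fun x => ?_)
    fun x => Prod.ext ((h x _).1 (normalBasis (hS x) k).2) (proj_normalBasis (hS x) k)
  rw [injective_iff_map_eq_zero]
  intro y hy
  have hy1 : y ∈ S x := (h x y).2 (congrArg Prod.fst hy)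
  have hy2 : coords α I (S x) ⟨y, hy1⟩ = 0 := congrArg Prod.snd hy
  exact congrArg Subtype.val
    ((injective_iff_map_eq_zero (coords α I (S x))).1 (hS x).bijective.1 _ hy2)

/-- The normal basis of the image of a regular family `f` is regular: the linear map `σ` that sends
the unit vectors to the normal basis is the unique one with `σ ∘ proj ∘ f = f`. -/
theorem Variety.IsRegularMap.normalBasis_range (hS : ∀ x, InCell α I (S x))
    {f : X → (M →ₗ[ℂ] A)} (hf : IsRegularMap ι f) (h : ∀ x y, y ∈ S x ↔ ∃ z, f x z = y)
    (k : Fin r) : IsRegularMap ι (fun x => ((normalBasis (hS x) k : S x) : A)) := by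
  have := Module.Finite.of_basis α
  let σ : X → ((Fin r → ℂ) →ₗ[ℂ] A) := fun x =>
    Fintype.linearCombination ℂ fun k => ((normalBasis (hS x) k : S x) : A)
  have hpf : IsRegularMap ι (fun x => proj α I ∘ₗ f x) :=
    (isRegularMap_const ι (proj α I)).comp hf
  have hσ : IsRegularMap ι σ := by
    refine (hpf.map (LinearMap.llcomp ℂ M (Fin r → ℂ) A).flip).solve hf (fun x => ?_) fun x => ?_
    · refine LinearMap.lcomp_injective_of_surjective _ fun w => ?_
      obtain ⟨⟨y, hy⟩, rfl⟩ := (hS x).bijective.2 w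
      obtain ⟨z, rfl⟩ := (h x y).1 hy
      exact ⟨z, rfl⟩
    · ext z
      exact sum_proj_smul_normalBasis (hS x) ((h x _).2 ⟨z, rfl⟩)
  have := hσ.apply (isRegularMap_const ι (Pi.single k 1 : Fin r → ℂ))
  simpa [σ, Fintype.linearCombination_apply_single] using this

end NormalBasis

/-! ### The strata as varieties -/

section Strata

open Variety Echelon Topology

variable {Λ : Type u} [Ring Λ] [Algebra ℂ Λ] {A B A' B' L : Type u}
  [AddCommGroup A] [Module ℂ A] [Module Λ A] [IsScalarTower ℂ Λ A]
  [AddCommGroup B] [Module ℂ B] [Module Λ B] [IsScalarTower ℂ Λ B]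
  [AddCommGroup A'] [Module ℂ A'] [Module Λ A'] [IsScalarTower ℂ Λ A']
  [AddCommGroup B'] [Module ℂ B'] [Module Λ B'] [IsScalarTower ℂ Λ B']
  [AddCommGroup L] [Module ℂ L] [Module Λ L] [IsScalarTower ℂ Λ L]

/-- The inclusion of the `Λ`-linear maps into the `ℂ`-linear maps. -/
abbrev scalarRestriction (Λ M N : Type*) [Ring Λ] [Algebra ℂ Λ] [AddCommGroup M] [Module ℂ M]
    [Module Λ M] [IsScalarTower ℂ Λ M] [AddCommGroup N] [Module ℂ N] [Module Λ N]
    [IsScalarTower ℂ Λ N] : (M →ₗ[Λ] N) →ₗ[ℂ] (M →ₗ[ℂ] N) :=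
  LinearMap.restrictScalarsₗ ℂ Λ M N ℂ

/-- A family of `Λ`-linear maps is regular as soon as it is regular as a family of `ℂ`-linear
maps. -/
theorem Variety.IsRegularMap.of_restrictScalars {V X M N : Type*} [AddCommGroup V] [Module ℂ V]
    {ι : X → V} [AddCommGroup M] [Module ℂ M] [Module Λ M] [IsScalarTower ℂ Λ M]
    [AddCommGroup N] [Module ℂ N] [Module Λ N] [IsScalarTower ℂ Λ N] {F : X → (M →ₗ[Λ] N)}
    (hF : IsRegularMap ι (fun x => (F x).restrictScalars ℂ)) : IsRegularMap ι F :=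
  .of_injective (scalarRestriction Λ M N) (LinearMap.restrictScalars_injective ℂ) hF

variable {X : Type*} (ι : X → QuadSpace Λ A B A' B' L)

theorem isRegularMap_a : IsRegularMap ι (fun x => (ι x).1.restrictScalars ℂ) :=
  (isRegularMap_self ι).map (scalarRestriction Λ L A ∘ₗ LinearMap.fst ℂ _ _)

theorem isRegularMap_b : IsRegularMap ι (fun x => (ι x).2.1.restrictScalars ℂ) :=
  (isRegularMap_self ι).map
    (scalarRestriction Λ B L ∘ₗ LinearMap.fst ℂ _ _ ∘ₗ LinearMap.snd ℂ _ _)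

theorem isRegularMap_a' : IsRegularMap ι (fun x => (ι x).2.2.1.restrictScalars ℂ) :=
  (isRegularMap_self ι).map (scalarRestriction Λ L A' ∘ₗ LinearMap.fst ℂ _ _ ∘ₗ
    LinearMap.snd ℂ _ _ ∘ₗ LinearMap.snd ℂ _ _)

theorem isRegularMap_b' : IsRegularMap ι (fun x => (ι x).2.2.2.restrictScalars ℂ) :=
  (isRegularMap_self ι).map (scalarRestriction Λ B' L ∘ₗ LinearMap.snd ℂ _ _ ∘ₗ
    LinearMap.snd ℂ _ _ ∘ₗ LinearMap.snd ℂ _ _)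

theorem comap_range_eq_ker (q : Quadruples Λ A B A' B' L) :
    (LinearMap.range q.1.2.2.2).comap q.1.2.1 = LinearMap.ker (q.1.2.2.1 ∘ₗ q.1.2.1) := by
  ext x
  exact (q.2.2.2.1 _).symm

variable {m n : ℕ} (α : Module.Basis (Fin m) ℂ A) (β : Module.Basis (Fin n) ℂ B)

/-- The linear map `(…, c, d) ↦ (pr₁ c, d i₁, pr₂ c, d i₂)` from the coordinates of octets to
quadruples of homomorphisms. -/
noncomputable def octetToQuad (Λ : Type u) [Ring Λ] [Algebra ℂ Λ] (A B A' B' L : Type u)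
    [AddCommGroup A] [Module ℂ A] [Module Λ A] [IsScalarTower ℂ Λ A]
    [AddCommGroup B] [Module ℂ B] [Module Λ B] [IsScalarTower ℂ Λ B]
    [AddCommGroup A'] [Module ℂ A'] [Module Λ A'] [IsScalarTower ℂ Λ A']
    [AddCommGroup B'] [Module ℂ B'] [Module Λ B'] [IsScalarTower ℂ Λ B']
    [AddCommGroup L] [Module ℂ L] [Module Λ L] [IsScalarTower ℂ Λ L] (r s : ℕ) :
    OctetSpace Λ A B A' B' L r s →ₗ[ℂ] QuadSpace Λ A B A' B' L where
  toFun w := (LinearMap.fst Λ A A' ∘ₗ w.2.2.2.2.2.2.1, w.2.2.2.2.2.2.2 ∘ₗ LinearMap.inl Λ B B',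
    LinearMap.snd Λ A A' ∘ₗ w.2.2.2.2.2.2.1, w.2.2.2.2.2.2.2 ∘ₗ LinearMap.inr Λ B B')
  map_add' _ _ := rfl
  map_smul' _ _ := rfl

theorem octetToQuad_octetCoord {I : Index m} {J : Index n}
    (q : (quadStratum α β I J : Set (Quadruples Λ A B A' B' L)))
    (o : (octetStratum α β I J : Set (Octet Λ A B A' B' L))) (h : IsInduced q.1 o.1) :
    octetToQuad Λ A B A' B' L I.1 J.1 (octetCoord α β I J o) = quadCoord α β I J q := by
  refine Prod.ext ?_ (Prod.ext ?_ (Prod.ext ?_ ?_))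
  · exact LinearMap.ext fun l => congrArg Prod.fst (h.c_eq l)
  · exact LinearMap.ext fun x => (h.d_eq x 0).trans (by rw [map_zero, add_zero]; rfl)
  · exact LinearMap.ext fun l => congrArg Prod.snd (h.c_eq l)
  · exact LinearMap.ext fun y => (h.d_eq 0 y).trans (by rw [map_zero, zero_add]; rfl)

theorem IsInduced.mem_octetStratum_iff {q : Quadruples Λ A B A' B' L} {o : Octet Λ A B A' B' L}
    (h : IsInduced q o) (I : Index m) (J : Index n) :
    q ∈ quadStratum α β I J ↔ o ∈ octetStratum α β I J := by
  change _ ∧ _ ↔ _ ∧ _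
  rw [h.S_eq, h.T_eq]

variable [Module.Finite ℂ A] [Module.Finite ℂ B] [Module.Finite ℂ A'] [Module.Finite ℂ B']
  [Module.Finite ℂ L]

theorem isLocallyClosed_quadruples :
    @IsLocallyClosed _ (zariski _) (Quadruples Λ A B A' B' L) := by
  let := zariski (QuadSpace Λ A B A' B' L)
  have ha := isRegularMap_a (id : QuadSpace Λ A B A' B' L → _)
  have hb := isRegularMap_b (id : QuadSpace Λ A B A' B' L → _)
  have ha' := isRegularMap_a' (id : QuadSpace Λ A B A' B' L → _)
  have hb' := isRegularMap_b' (id : QuadSpace Λ A B A' B' L → _)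
  have o1 := isOpen_of_zariskiOn_id (hb.isOpen_injective)
  have o2 := isOpen_of_zariskiOn_id (ha.isOpen_surjective)
  have o3 := isOpen_of_zariskiOn_id (hb'.isOpen_injective)
  have o4 := isOpen_of_zariskiOn_id (ha'.isOpen_surjective)
  have c1 := isClosed_of_zariskiOn_id ((ha.comp hb).isClosed_eq_zero)
  have c2 := isClosed_of_zariskiOn_id ((ha'.comp hb').isClosed_eq_zero)
  have h := ((o1.inter o2).inter (o3.inter o4)).isLocallyClosed.inter
    (c1.inter c2).isLocallyClosed
  have h' := h.inter (isOpen_const (p := Module.finrank ℂ L = Module.finrank ℂ B +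
    Module.finrank ℂ A ∧ Module.finrank ℂ L = Module.finrank ℂ B' +
    Module.finrank ℂ A')).isLocallyClosed
  convert h' using 1
  ext ⟨a, b, a', b'⟩
  have key : ∀ {M N P : Type u} [AddCommGroup M] [AddCommGroup N] [AddCommGroup P] [Module ℂ M]
      [Module ℂ N] [Module ℂ P] [Module Λ M] [Module Λ N] [Module Λ P] [IsScalarTower ℂ Λ M]
      [IsScalarTower ℂ Λ N] [IsScalarTower ℂ Λ P] (f : M →ₗ[Λ] N) (g : N →ₗ[Λ] P),
      g.restrictScalars ℂ ∘ₗ f.restrictScalars ℂ = 0 ↔ g ∘ₗ f = 0 := fun f g =>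
    ⟨fun h => LinearMap.ext fun x => LinearMap.congr_fun h x,
      fun h => LinearMap.ext fun x => LinearMap.congr_fun h x⟩
  constructor
  · rintro ⟨⟨h1, h2, h3⟩, h4, h5, h6⟩
    obtain ⟨h7, h8⟩ := (exact_iff_finrank h1 h3).1 h2
    obtain ⟨h9, h10⟩ := (exact_iff_finrank h4 h6).1 h5
    exact ⟨⟨⟨⟨h1, h3⟩, h4, h6⟩, (key _ _).2 h7, (key _ _).2 h9⟩, h8, h10⟩
  · rintro ⟨⟨⟨⟨h1, h3⟩, h4, h6⟩, h7, h9⟩, h8, h10⟩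
    exact ⟨⟨h1, (exact_iff_finrank h1 h3).2 ⟨(key _ _).1 h7, h8⟩, h3⟩,
      h4, (exact_iff_finrank h4 h6).2 ⟨(key _ _).1 h9, h10⟩, h6⟩

theorem isVariety_quadCoord (I : Index m) (J : Index n) :
    IsVariety (quadCoord (Λ := Λ) (A' := A') (B' := B') (L := L) α β I J) := by
  refine ⟨fun q q' h => Subtype.ext (Subtype.ext h), ?_⟩
  let := zariski (QuadSpace Λ A B A' B' L)
  have hab := (isRegularMap_a (id : QuadSpace Λ A B A' B' L → _)).comp (isRegularMap_b' id)
  have hba := (isRegularMap_a' (id : QuadSpace Λ A B A' B' L → _)).comp (isRegularMap_b id)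
  have hp : ∀ I' : Fin I.1 ↪o Fin m, IsRegularMap (id : QuadSpace Λ A B A' B' L → _)
      (fun x => proj α I' ∘ₗ (x.1.restrictScalars ℂ ∘ₗ x.2.2.2.restrictScalars ℂ)) := fun I' =>
    (isRegularMap_const _ _).comp hab
  have hg : ∀ J' : Fin J.1 ↪o Fin n, IsRegularMap (id : QuadSpace Λ A B A' B' L → _)
      (fun x => (x.2.2.1.restrictScalars ℂ ∘ₗ x.2.1.restrictScalars ℂ).prod (proj β J')) :=
    fun J' => (hba.prodMk (isRegularMap_const _ (proj β J'))).map
      (LinearMap.prodEquiv (R := ℂ) (M := B) (M₂ := A') (M₃ := Fin J.1 → ℂ) ℂ).toLinearMap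
  have c1 := isClosed_of_zariskiOn_id (hab.isClosed_finrank_range_le I.1)
  have c2 := isClosed_of_zariskiOn_id (hba.isClosed_finrank_range_le (n - J.1))
  have o1 := isOpen_of_zariskiOn_id ((hp I.2).isOpen_surjective)
  have o2 := isOpen_of_zariskiOn_id ((hg J.2).isOpen_injective)
  have o3 := fun I' => isOpen_of_zariskiOn_id ((hp I').isOpen_surjective)
  have o4 := fun J' => isOpen_of_zariskiOn_id ((hg J').isOpen_injective)
  have c3 := isClosed_iInter fun (I' : Fin I.1 ↪o Fin m) => isClosed_iInter fun
    (_ : toLex (I' : Fin I.1 → Fin m) < toLex (I.2 : Fin I.1 → Fin m)) => (o3 I').isClosed_compl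
  have c4 := isClosed_iInter fun (J' : Fin J.1 ↪o Fin n) => isClosed_iInter fun
    (_ : toLex (J' : Fin J.1 → Fin n) < toLex (J.2 : Fin J.1 → Fin n)) => (o4 J').isClosed_compl
  have h := (isLocallyClosed_quadruples (Λ := Λ) (A := A) (B := B) (A' := A') (B' := B')
    (L := L)).inter (((c1.inter c3).inter (c2.inter c4)).isLocallyClosed.inter
      (o1.inter o2).isLocallyClosed)
  convert h using 1
  have hJ : (J.1 : ℕ) ≤ n := Nat.lt_succ_iff.1 J.1.2
  have key : ∀ q : Quadruples Λ A B A' B' L, q ∈ quadStratum α β I J ↔ _ := fun q =>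
    and_congr (inCell_range_iff α I.2 (q.1.1 ∘ₗ q.1.2.2.2))
      ((comap_range_eq_ker q ▸ Iff.rfl : InCell β J.2 _ ↔ InCell β J.2 _).trans
        (inCell_ker_iff β J.2 hJ (q.1.2.2.1 ∘ₗ q.1.2.1)))
  ext v
  constructor
  · rintro ⟨⟨q, hq⟩, rfl⟩
    obtain ⟨⟨h1, h2, h3⟩, h4, h5, h6⟩ := (key q).1 hq
    exact ⟨q.2, ⟨⟨h1, Set.mem_iInter₂.2 h3⟩, h4, Set.mem_iInter₂.2 h6⟩, h2, h5⟩
  · rintro ⟨hv, ⟨⟨h1, h3⟩, h4, h6⟩, h2, h5⟩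
    exact ⟨⟨⟨v, hv⟩, (key ⟨v, hv⟩).2 ⟨⟨h1, h2, Set.mem_iInter₂.1 h3⟩, h4, h5,
      Set.mem_iInter₂.1 h6⟩⟩, rfl⟩

/-- The octet induced by a quadruple depends on it by a morphism: all its coordinates solve systems
of linear equations whose coefficients are regular. -/
theorem isMorphism_of_isInduced (I : Index m) (J : Index n)
    (h : ↥(quadStratum α β I J : Set (Quadruples Λ A B A' B' L)) →
      ↥(octetStratum α β I J : Set (Octet Λ A B A' B' L)))
    (hh : ∀ q, IsInduced q.1 (h q).1) :
    IsMorphism (quadCoord α β I J) (octetCoord α β I J) h := by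
  have ha := isRegularMap_a (quadCoord (Λ := Λ) (A' := A') (B' := B') (L := L) α β I J)
  have hb := isRegularMap_b (quadCoord (Λ := Λ) (A' := A') (B' := B') (L := L) α β I J)
  have ha' := isRegularMap_a' (quadCoord (Λ := Λ) (A' := A') (B' := B') (L := L) α β I J)
  have hb' := isRegularMap_b' (quadCoord (Λ := Λ) (A' := A') (B' := B') (L := L) α β I J)
  have hs : ∀ k, IsRegularMap (quadCoord (Λ := Λ) (A' := A') (B' := B') (L := L) α β I J)
      (fun q => ((normalBasis (h q).2.1 k : (h q).1.S) : A)) := fun k =>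
    IsRegularMap.normalBasis_range (fun q => (h q).2.1) (ha.comp hb') (fun q y => by
      rw [(hh q).S_eq]
      rfl) k
  have ht : ∀ k, IsRegularMap (quadCoord (Λ := Λ) (A' := A') (B' := B') (L := L) α β I J)
      (fun q => ((normalBasis (h q).2.2 k : (h q).1.T) : B)) := fun k =>
    IsRegularMap.normalBasis_ker (fun q => (h q).2.2) (ha'.comp hb) (fun q y => by
      rw [(hh q).T_eq, comap_range_eq_ker]
      rfl) k
  have he : ∀ k, IsRegularMap (quadCoord (Λ := Λ) (A' := A') (B' := B') (L := L) α β I J)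
      (fun q => (h q).1.e₁ (normalBasis (h q).2.2 k)) := fun k =>
    hb'.solve (hb.apply (ht k)) (fun q => q.1.2.2.1) fun q => (hh q).e₁_eq _
  -- The composition of `e₄` with the section of `A → A / S` is determined by its composition with
  -- the surjection `a'`.
  have h4 : IsRegularMap (quadCoord (Λ := Λ) (A' := A') (B' := B') (L := L) α β I J)
      (fun q => Echelon.lift (h q).2.1 ∘ₗ (h q).1.e₄.restrictScalars ℂ) := by
    have hred : IsRegularMap (quadCoord (Λ := Λ) (A' := A') (B' := B') (L := L) α β I J)
        (fun q => reduce (h q).2.1) :=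
      (isRegularMap_const _ _).sub (IsRegularMap.sum _ fun k _ =>
        (hs k).map (LinearMap.smulRightₗ (α.coord (I.2 k))))
    refine (ha'.map (LinearMap.llcomp ℂ L A' A).flip).solve (hred.comp ha) (fun q => ?_)
      fun q => ?_
    · exact LinearMap.lcomp_injective_of_surjective _ q.1.2.2.2.2
    · ext l
      exact congrArg (Echelon.lift (h q).2.1) ((hh q).e₄_eq l)
  have h2 : IsRegularMap (quadCoord (Λ := Λ) (A' := A') (B' := B') (L := L) α β I J)
      (fun q => (h q).1.e₂ ∘ₗ (h q).1.T.mkQ) := by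
    refine .of_restrictScalars ?_
    convert ha'.comp hb using 2 with q
    ext x
    exact (hh q).e₂_eq x
  have h3 : IsRegularMap (quadCoord (Λ := Λ) (A' := A') (B' := B') (L := L) α β I J)
      (fun q => (h q).1.S.subtype ∘ₗ (h q).1.e₃) := by
    refine .of_restrictScalars ?_
    convert ha.comp hb' using 2 with q
    ext x
    exact (hh q).e₃_eq x
  have hc : IsRegularMap (quadCoord (Λ := Λ) (A' := A') (B' := B') (L := L) α β I J)
      (fun q => (h q).1.pullback.subtype ∘ₗ (h q).1.c) := by
    refine .of_restrictScalars ?_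
    convert (ha.prodMk ha').map
      (LinearMap.prodEquiv (R := ℂ) (M := L) (M₂ := A) (M₃ := A') ℂ).toLinearMap using 2 with q
    ext x
    · exact congrArg Prod.fst ((hh q).c_eq x)
    · exact congrArg Prod.snd ((hh q).c_eq x)
  have hd : IsRegularMap (quadCoord (Λ := Λ) (A' := A') (B' := B') (L := L) α β I J)
      (fun q => (h q).1.d ∘ₗ (h q).1.relations.mkQ) := by
    refine .of_restrictScalars ?_
    convert (hb.prodMk hb').map
      (LinearMap.coprodEquiv (R := ℂ) (M := B) (M₂ := B') (M₃ := L) ℂ).toLinearMap using 2 with q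
    exact LinearMap.ext fun z => (hh q).d_eq z.1 z.2
  exact (IsRegularMap.pi hs).prodMk ((IsRegularMap.pi ht).prodMk ((IsRegularMap.pi he).prodMk
    (h2.prodMk (h3.prodMk (h4.prodMk (hc.prodMk hd))))))

end Strata

/-! ### The comparison of the strata -/

theorem existsUnique_prod {X Y : Type*} {p : X → Prop} {q : Y → Prop} (hp : ∃! x, p x)
    (hq : ∃! y, q y) : ∃! z : X × Y, p z.1 ∧ q z.2 := by
  obtain ⟨x, hx, hx'⟩ := hp
  obtain ⟨y, hy, hy'⟩ := hq
  exact ⟨(x, y), ⟨hx, hy⟩, fun z hz => Prod.ext (hx' _ hz.1) (hy' _ hz.2)⟩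

theorem proposition5p6
    (Λ : Type u) [Ring Λ] [Algebra ℂ Λ] [Module.Finite ℂ Λ] (A B A' B' L : Type u)
    [AddCommGroup A] [Module ℂ A] [Module Λ A] [IsScalarTower ℂ Λ A] [Module.Finite ℂ A]
    [AddCommGroup B] [Module ℂ B] [Module Λ B] [IsScalarTower ℂ Λ B] [Module.Finite ℂ B]
    [AddCommGroup A'] [Module ℂ A'] [Module Λ A'] [IsScalarTower ℂ Λ A'] [Module.Finite ℂ A']
    [AddCommGroup B'] [Module ℂ B'] [Module Λ B'] [IsScalarTower ℂ Λ B'] [Module.Finite ℂ B']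
    [AddCommGroup L] [Module ℂ L] [Module Λ L] [IsScalarTower ℂ Λ L] [Module.Finite ℂ L] :
    ∃ η : Quadruples Λ A B A' B' L → Octet Λ A B A' B' L,
      Function.Bijective η ∧ (∀ q, IsInduced q (η q)) ∧
      ∀ (m n : ℕ) (α : Module.Basis (Fin m) ℂ A) (β : Module.Basis (Fin n) ℂ B),
        (∀ q : Quadruples Λ A B A' B' L,
          ∃! IJ : Echelon.Index m × Echelon.Index n, q ∈ quadStratum α β IJ.1 IJ.2) ∧
        (∀ o : Octet Λ A B A' B' L,
          ∃! IJ : Echelon.Index m × Echelon.Index n, o ∈ octetStratum α β IJ.1 IJ.2) ∧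
        ∀ (I : Echelon.Index m) (J : Echelon.Index n),
          Variety.IsVariety
            (quadCoord (Λ := Λ) (A' := A') (B' := B') (L := L) α β I J) ∧
          Variety.IsVariety
            (octetCoord (Λ := Λ) (A' := A') (B' := B') (L := L) α β I J) ∧
          ∃ h : (quadStratum α β I J : Set (Quadruples Λ A B A' B' L)) ≃
              (octetStratum α β I J : Set (Octet Λ A B A' B' L)),
            (∀ q, (h q : Octet Λ A B A' B' L) = η q) ∧
            @IsHomeomorph _ _ (Variety.zariskiOn (quadCoord α β I J))
              (Variety.zariskiOn (octetCoord α β I J)) h ∧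
            Variety.IsMorphism (quadCoord α β I J) (octetCoord α β I J) h ∧
            Variety.IsMorphism (octetCoord α β I J) (quadCoord α β I J) h.symm := by
  choose η hη using fun q : Quadruples Λ A B A' B' L => exists_octet_isInduced q
  have hbij : Function.Bijective η := by
    refine ⟨fun q q' h => (hη q).quadruple_unique (h ▸ hη q'), fun o => ?_⟩
    obtain ⟨q, hq⟩ := exists_quadruple_isInduced o
    exact ⟨q, (hη q).octet_unique hq⟩
  refine ⟨η, hbij, hη, fun m n α β => ⟨fun q => ?_, fun o => ?_, fun I J => ?_⟩⟩
  · exact existsUnique_prod (Echelon.existsUnique_inCell α _) (Echelon.existsUnique_inCell β _)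
  · exact existsUnique_prod (Echelon.existsUnique_inCell α _) (Echelon.existsUnique_inCell β _)
  let h : (quadStratum α β I J : Set (Quadruples Λ A B A' B' L)) ≃
      (octetStratum α β I J : Set (Octet Λ A B A' B' L)) :=
    (Equiv.ofBijective η hbij).subtypeEquiv fun q => (hη q).mem_octetStratum_iff α β I J
  have hh : ∀ q, IsInduced q.1 (h q).1 := fun q => hη q.1
  have hmor := isMorphism_of_isInduced α β I J h hh
  have hinv : ∀ o, octetToQuad Λ A B A' B' L I.1 J.1 (octetCoord α β I J o) =
      quadCoord α β I J (h.symm o) := fun o =>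
    octetToQuad_octetCoord α β (h.symm o) o (by simpa using hh (h.symm o))
  have hmor' : Variety.IsMorphism (octetCoord α β I J) (quadCoord α β I J) h.symm := by
    have := (Variety.isRegularMap_self (octetCoord (Λ := Λ) (A' := A') (B' := B') (L := L)
      α β I J)).map (octetToQuad Λ A B A' B' L I.1 J.1)
    simp only [hinv] at this
    exact this
  have hvar := isVariety_quadCoord (Λ := Λ) (A' := A') (B' := B') (L := L) α β I J
  exact ⟨hvar, hvar.of_linear_symm h hmor _ hinv, h, fun q => rfl,
    Variety.isHomeomorph_of_isMorphism h hmor hmor', hmor, hmor'⟩
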